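/- Let $z:[0,\infty)\to[0,\infty]$ be nonincreasing and lower semi-continuous with $z(\phi)<\infty$ for all $\phi>0$, and put $c(\phi)=\phi\,z(\phi)$ for $\phi>0$ and $c(0)=0$. For a locally absolutely continuous function $\psi:\mathbb R\to\mathbb R$ set $$F^c[\psi]=\int_{\mathbb R}\tfrac12|\psi'(y)|^2+c(|\psi(y)|)\,\mathrm dy\in[0,\infty],$$ and for $w\ge0$ let $$\tau^z(w)=\inf\Big\{F^c[\psi]\ \Big|\ \psi\in L^1(\mathbb R)\text{ locally absolutely continuous},\ \int_{\mathbb R}\psi\,\mathrm dy=w\Big\}.$$ Suppose that $\tau:=\tau^z$ is finite on $[0,\infty)$, and extend $\tau$ to $(-\infty,0)$ by $-\infty$. Let $[-\tau(-\cdot)]^*(t)=\sup_{x\in\mathbb R}\big(tx+\tau(-x)\big)=\sup_{w\ge0}\big(\tau(w)-tw\big)$ denote the Legendre--Fenchel conjugate of $x\mapsto-\tau(-x)$. Let $z^{-1}(x)=\inf\{y\in[0,\infty)\mid z(y)\le x\}$ for $x\ge0$ (with $\inf\emptyset=\infty$) be the generalized inverse of $z$, let $g=(z^{-1})^{3/2}:[0,\infty)\to[0,\infty]$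 (with $\infty^{3/2}=\infty$), and let $r(s)=\frac{2\sqrt2}{3\sqrt{-s}}$ for $s<0$ and $r(s)=0$ for $s\ge0$. **Theorem (Necessary condition).** For every $t\in\{\tau'(w)\mid w\ge0,\ \tau\text{ is differentiable at }w\}$ (where for $w=0$ differentiability means existence of a finite right derivative), $$[-\tau(-\cdot)]^*(t)=[g*r](t)=\int_0^\infty g(s)\,r(t-s)\,\mathrm ds ,$$ with the convention $\infty\cdot0=0$ in the integrand. -/

import Mathlib

open MeasureTheory Set
open scoped NNReal ENNReal

namespace PhaseField

/-- The phase field cost `c(φ) = φ z(φ)` belonging to a mass-specific phase field cost `z`.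
Here `z 0 = ∞` is allowed, and `c(0) = 0` also in that case (as `0 * ∞ = 0` in `ℝ≥0∞`). -/
noncomputable def phaseFieldCost (z : ℝ≥0 → ℝ≥0∞) (φ : ℝ≥0) : ℝ≥0∞ :=
  (φ : ℝ≥0∞) * z φ

/-- The phase field energy `F^c[ψ] = ∫_ℝ ½ |ψ'(y)|² + c(|ψ(y)|) dy ∈ [0, ∞]` of a locally
absolutely continuous function `ψ`. -/
noncomputable def energy (c : ℝ≥0 → ℝ≥0∞) (ψ : ℝ → ℝ) : ℝ≥0∞ :=
  ∫⁻ y : ℝ, (ENNReal.ofReal ((1 / 2) * |deriv ψ y| ^ 2) + c ‖ψ y‖₊)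

/-- Phase field functions of mass `w`: Lebesgue integrable with `∫_ℝ ψ dy = w`, and locally
absolutely continuous, i.e. (the continuous representative of) a function in `W^{1,1}_loc(ℝ)`;
then the a.e. derivative `deriv ψ` is the weak derivative of `ψ`. -/
structure IsPhaseField (ψ : ℝ → ℝ) (w : ℝ≥0) : Prop where
  absCont : ∀ a b : ℝ, AbsolutelyContinuousOnInterval ψ a b
  integrable : Integrable ψ
  mass : ∫ y : ℝ, ψ y = (w : ℝ)

/-- The transport cost induced by the phase field cost `c`:
`w ↦ inf { F^c[ψ] | ∫_ℝ ψ dy = w } ∈ [0, ∞]`. -/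
noncomputable def inducedCost (c : ℝ≥0 → ℝ≥0∞) (w : ℝ≥0) : ℝ≥0∞ :=
  ⨅ (ψ : ℝ → ℝ) (_ : IsPhaseField ψ w), energy c ψ

/-- `τ^z`, the transport cost induced by `c(φ) = φ z(φ)`. -/
noncomputable def tauOf (z : ℝ≥0 → ℝ≥0∞) : ℝ≥0 → ℝ≥0∞ :=
  inducedCost (phaseFieldCost z)

/-- The generalized inverse `z⁻¹(x) = inf { y ∈ [0, ∞) | z(y) ≤ x }`, with `inf ∅ = ∞`. -/
noncomputable def genInv (z : ℝ≥0 → ℝ≥0∞) (x : ℝ≥0) : ℝ≥0∞ :=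
  ⨅ (y : ℝ≥0) (_ : z y ≤ (x : ℝ≥0∞)), (y : ℝ≥0∞)

/-- `g = (z⁻¹)^{3/2}`, with `∞^{3/2} = ∞`. -/
noncomputable def gOf (z : ℝ≥0 → ℝ≥0∞) (s : ℝ≥0) : ℝ≥0∞ :=
  genInv z s ^ (3 / 2 : ℝ)

/-- The convolution kernel `r(s) = 2√2 / (3 √(-s))` for `s < 0`, and `r(s) = 0` otherwise. -/
noncomputable def kernelR (s : ℝ) : ℝ :=
  if s < 0 then 2 * √2 / (3 * √(-s)) else 0

/-- The convolution `[g * r](t) = ∫ g(s) r(t - s) ds ∈ [0, ∞]` of a function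
`g : [0, ∞) → [0, ∞]` with a nonnegative function `r : ℝ → ℝ`. -/
noncomputable def conv (g : ℝ≥0 → ℝ≥0∞) (r : ℝ → ℝ) (t : ℝ) : ℝ≥0∞ :=
  ∫⁻ s in Ici (0 : ℝ), g s.toNNReal * ENNReal.ofReal (r (t - s))

/-- The Legendre–Fenchel conjugate `f*(t) = sup_x (t x - f(x))`. -/
noncomputable def fenchelConj (f : ℝ → EReal) (t : ℝ) : EReal :=
  ⨆ x : ℝ, ((t * x : ℝ) : EReal) - f x

/-- The extension of a transport cost to `ℝ` by `-∞` on `(-∞, 0)`. -/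
noncomputable def extendBot (τ : ℝ≥0 → ℝ≥0) (x : ℝ) : EReal :=
  if 0 ≤ x then (((τ x.toNNReal : ℝ≥0) : ℝ) : EReal) else ⊥

end PhaseField

/-!
Write `F` for the energy, `ζ = z⁻¹` for the generalized inverse of `z`, and `H(t)` for the
convolution `[g * r](t)`. The identity holds because both sides are the value of the unconstrained
problem of minimizing `F[ψ] - t ∫ ψ` over profiles `ψ` that climb to a height `M` with `z(M) = t`
and descend again. By equipartition of energy such a profile moves with speed
`|ψ'| = √(2 ψ (z(ψ) - t))`, so its value is `2 ∫₀^{ζ(t)} √(2 φ (z(φ) - t)) dφ`. Writing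
`√(z - t) = ∫_{t < s < z} ds / (2 √(s - t))` and exchanging the integrals turns this number
into `H(t)`.

*Upper bound* (`tauOf_le_add_conv`): `τ(w) ≤ t w + H(t)` for all `w, t ≥ 0`. The cost is replaced
by a continuous majorant, its mean value over `[l x, x]` with `l < 1`, whose error is controlled by
scaling as `l → 1`; then `exists_profile` produces the profile with the prescribed speed as the
inverse of its travel time. A small extra speed `σ` keeps the travel time regular, and it lets the
mass of the profile range over all of `(0, ∞)` when its maximum varies.

*Lower bound* (`le_energy`): if `ψ` has maximum `M` and `t ≤ z(M)`, Young's inequality and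
the fundamental theorem of calculus give
`F[ψ] ≥ t w + ∫_{s > t} r(t - s) min(M, ζ(s))^{3/2} ds`. It remains to see that almost optimal
profiles have maxima with `z(M) ≈ t` if `τ'(w) = t` and `w > 0` (`exists_almost_optimal`). This
follows from two variations of `ψ` that change the mass by a small amount `δ`: a plateau inserted at
the maximum costs `δ z(M)`, which gives `z(M) ≥ t` up to an error, and an excision of mass `δ` saves
at least `δ z(M)`, which gives `z(M) ≤ t` up to an error. The excised part lies over an interval
with equal values of `ψ` at its ends; a shortest interval carrying the mass `δ` has this property
(`exists_interval_of_mass`). Fatou's lemma then yields `τ(w) - t w ≥ H(t)`.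

At `w = 0` the slope `t` bounds `z` from above (`le_of_hasDerivWithinAt_zero`), so that
`H(t) = 0 = τ(0)`.
-/

namespace PhaseField

open Filter Topology

/-! ### Locally absolutely continuous functions, gluing, and localization of the energy -/

/-- Local absolute continuity on `ℝ`: absolute continuity on every compact interval. -/
def LocAbsCont (f : ℝ → ℝ) : Prop := ∀ a b : ℝ, AbsolutelyContinuousOnInterval f a b

namespace LocAbsCont

variable {f g : ℝ → ℝ}

lemma continuous (hf : LocAbsCont f) : Continuous f := by
  rw [continuous_iff_continuousAt]
  intro x
  have := (hf (x - 1) (x + 1)).continuousOn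
  rw [uIcc_of_le (by linarith)] at this
  exact this.continuousAt (Icc_mem_nhds (by linarith) (by linarith))

lemma ae_differentiableAt (hf : LocAbsCont f) : ∀ᵐ x : ℝ, DifferentiableAt ℝ f x := by
  have h : ∀ᵐ x : ℝ, ∀ n : ℕ, x ∈ uIcc (-(n : ℝ)) n → DifferentiableAt ℝ f x :=
    ae_all_iff.2 fun n => (hf _ _).ae_differentiableAt
  filter_upwards [h] with x hx
  obtain ⟨n, hn⟩ := exists_nat_ge |x|
  refine hx n ?_
  rw [uIcc_of_le (by linarith [abs_nonneg x])]
  exact abs_le.1 hn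

lemma intervalIntegrable_deriv (hf : LocAbsCont f) (a b : ℝ) :
    IntervalIntegrable (deriv f) volume a b := (hf a b).intervalIntegrable_deriv

lemma integral_deriv (hf : LocAbsCont f) (a b : ℝ) : ∫ x in a..b, deriv f x = f b - f a :=
  (hf a b).integral_deriv_eq_sub

/-- The indefinite integral of a locally integrable function is locally absolutely continuous. -/
lemma of_eq_add_integral {v : ℝ → ℝ} (c : ℝ) (hv : ∀ a b, IntervalIntegrable v volume a b)
    (h : ∀ x, f x = f c + ∫ s in c..x, v s) : LocAbsCont f := by
  intro a b
  have h1 : AbsolutelyContinuousOnInterval (fun _ : ℝ => f a) a b :=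
    (LipschitzWith.const (f a)).lipschitzOnWith.absolutelyContinuousOnInterval
  have h2 := (hv a b).absolutelyContinuousOnInterval_intervalIntegral (c := a) left_mem_uIcc
  have h3 := h1.fun_add h2
  have h4 : (fun x => f a + ∫ s in a..x, v s) = f := by
    ext x
    rw [h x, h a, ← intervalIntegral.integral_add_adjacent_intervals (hv c a) (hv a x)]
    ring
  rwa [h4] at h3

lemma const (c : ℝ) : LocAbsCont fun _ => c := fun _ _ =>
  (LipschitzWith.const c).lipschitzOnWith.absolutelyContinuousOnInterval

lemma comp_add_right (hf : LocAbsCont f) (d : ℝ) : LocAbsCont fun x => f (x + d) := by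
  refine of_eq_add_integral 0 (v := fun x => deriv f (x + d)) (fun a b => ?_) (fun x => ?_)
  · simpa using (hf.intervalIntegrable_deriv (a + d) (b + d)).comp_add_right d
  · rw [intervalIntegral.integral_comp_add_right (deriv f), hf.integral_deriv]; ring

lemma comp_neg (hf : LocAbsCont f) : LocAbsCont fun x => f (-x) := by
  refine of_eq_add_integral 0 (v := fun x => -deriv f (-x)) (fun a b => ?_) (fun x => ?_)
  · simpa [Pi.neg_def] using ((hf.intervalIntegrable_deriv (-a) (-b)).comp_sub_left 0).neg
  · rw [intervalIntegral.integral_neg, intervalIntegral.integral_comp_neg (deriv f),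
      hf.integral_deriv]; ring

/-- Postcomposition with a function that is Lipschitz on the range preserves absolute
continuity. -/
lemma comp_lipschitzOn (hf : LocAbsCont f) {φ : ℝ → ℝ} {K : ℝ≥0}
    (hφ : LipschitzOnWith K φ (range f)) : LocAbsCont fun x => φ (f x) := by
  intro a b
  refine squeeze_zero (fun E => Finset.sum_nonneg fun i _ => dist_nonneg) (fun E => ?_)
    (by simpa using Filter.Tendsto.const_mul (K : ℝ) (hf a b))
  rw [Finset.mul_sum]
  exact Finset.sum_le_sum fun i _ =>
    hφ.dist_le_mul _ (mem_range_self _) _ (mem_range_self _)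

lemma abs (hf : LocAbsCont f) : LocAbsCont fun x => |f x| :=
  hf.comp_lipschitzOn (K := 1) (φ := fun x => |x|)
    ((LipschitzWith.of_dist_le_mul fun x y => by
      simpa [Real.dist_eq] using abs_abs_sub_abs_le x y).lipschitzOnWith)

end LocAbsCont

/-- The function that follows `f` up to the point `c` and `g` afterwards. -/
noncomputable def glue (c : ℝ) (f g : ℝ → ℝ) (x : ℝ) : ℝ := if x ≤ c then f x else g x

lemma glue_of_le {c x : ℝ} (f g : ℝ → ℝ) (h : x ≤ c) : glue c f g x = f x := if_pos h

lemma glue_of_lt {c x : ℝ} (f g : ℝ → ℝ) (h : c < x) : glue c f g x = g x := if_neg h.not_ge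

lemma LocAbsCont.glue {f g : ℝ → ℝ} (hf : LocAbsCont f) (hg : LocAbsCont g) {c : ℝ}
    (hc : f c = g c) : LocAbsCont (glue c f g) := by
  classical
  set v : ℝ → ℝ := (Iic c).piecewise (deriv f) (deriv g) with hv
  have hint : ∀ a b, IntervalIntegrable v volume a b := fun a b => by
    rw [intervalIntegrable_iff]
    refine Integrable.piecewise measurableSet_Iic ?_ ?_
    · exact (intervalIntegrable_iff.1 (hf.intervalIntegrable_deriv a b)).integrableOn
    · exact (intervalIntegrable_iff.1 (hg.intervalIntegrable_deriv a b)).integrableOn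
  refine of_eq_add_integral c hint fun x => ?_
  rw [glue_of_le _ _ le_rfl]
  rcases le_or_gt x c with h | h
  · rw [glue_of_le _ _ h, intervalIntegral.integral_congr (g := deriv f), hf.integral_deriv]
    · ring
    · intro s hs
      rw [uIcc_of_ge h] at hs
      exact piecewise_eq_of_mem _ _ _ hs.2
  · rw [glue_of_lt _ _ h, intervalIntegral.integral_congr_ae (g := deriv g), hg.integral_deriv, hc]
    · ring
    · refine Eventually.of_forall fun s hs => ?_
      rw [uIoc_of_le h.le] at hs
      exact piecewise_eq_of_notMem _ _ _ (notMem_Iic.2 hs.1)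

lemma integrable_glue {f g : ℝ → ℝ} {c : ℝ} (hf : IntegrableOn f (Iic c))
    (hg : IntegrableOn g (Ioi c)) : Integrable (glue c f g) := by
  classical
  have : glue c f g = (Iic c).piecewise f g := by
    ext x
    by_cases h : x ≤ c <;> simp [glue, h, piecewise]
  rw [this]
  exact Integrable.piecewise measurableSet_Iic hf (by simpa using hg)

lemma integral_glue {f g : ℝ → ℝ} {c : ℝ} (hf : IntegrableOn f (Iic c))
    (hg : IntegrableOn g (Ioi c)) :
    ∫ x, glue c f g x = (∫ x in Iic c, f x) + ∫ x in Ioi c, g x := by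
  rw [← integral_add_compl measurableSet_Iic (integrable_glue hf hg), compl_Iic]
  congr 1
  · exact setIntegral_congr_fun measurableSet_Iic fun x hx => glue_of_le _ _ hx
  · exact setIntegral_congr_fun measurableSet_Ioi fun x hx => glue_of_lt _ _ hx

/-- The integrand of the phase field energy. -/
noncomputable def energyDensity (c : ℝ≥0 → ℝ≥0∞) (ψ : ℝ → ℝ) (y : ℝ) : ℝ≥0∞ :=
  ENNReal.ofReal ((1 / 2) * |deriv ψ y| ^ 2) + c ‖ψ y‖₊

lemma energy_eq_lintegral (c : ℝ≥0 → ℝ≥0∞) (ψ : ℝ → ℝ) :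
    energy c ψ = ∫⁻ y, energyDensity c ψ y := rfl

lemma energyDensity_congr (c : ℝ≥0 → ℝ≥0∞) {f g : ℝ → ℝ} {y : ℝ} (h : f =ᶠ[𝓝 y] g) :
    energyDensity c f y = energyDensity c g y := by
  rw [energyDensity, energyDensity, h.deriv_eq, h.eq_of_nhds]

lemma energyDensity_comp_add (c : ℝ≥0 → ℝ≥0∞) (f : ℝ → ℝ) (d y : ℝ) :
    energyDensity c (fun x => f (x + d)) y = energyDensity c f (y + d) := by
  rw [energyDensity, energyDensity, deriv_comp_add_const]

lemma energyDensity_comp_sub (c : ℝ≥0 → ℝ≥0∞) (f : ℝ → ℝ) (d y : ℝ) :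
    energyDensity c (fun x => f (d - x)) y = energyDensity c f (d - y) := by
  rw [energyDensity, energyDensity, deriv_comp_const_sub, abs_neg]

lemma energyDensity_const (c : ℝ≥0 → ℝ≥0∞) (m y : ℝ) :
    energyDensity c (fun _ => m) y = c ‖m‖₊ := by simp [energyDensity]

lemma setLIntegral_energyDensity_glue_Iic (e : ℝ≥0 → ℝ≥0∞) {f g : ℝ → ℝ} {a c : ℝ} (h : a ≤ c) :
    ∫⁻ x in Iic a, energyDensity e (glue c f g) x = ∫⁻ x in Iic a, energyDensity e f x := by
  rw [setLIntegral_congr Iio_ae_eq_Iic.symm, setLIntegral_congr Iio_ae_eq_Iic.symm]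
  refine setLIntegral_congr_fun measurableSet_Iio fun x hx => energyDensity_congr e ?_
  filter_upwards [Iio_mem_nhds (lt_of_lt_of_le hx h)] with y hy using glue_of_le _ _ (le_of_lt hy)

lemma setLIntegral_energyDensity_glue_Ioi (e : ℝ≥0 → ℝ≥0∞) {f g : ℝ → ℝ} {a c : ℝ} (h : c ≤ a) :
    ∫⁻ x in Ioi a, energyDensity e (glue c f g) x = ∫⁻ x in Ioi a, energyDensity e g x := by
  refine setLIntegral_congr_fun measurableSet_Ioi fun x hx => energyDensity_congr e ?_
  filter_upwards [Ioi_mem_nhds (lt_of_le_of_lt h hx)] with y hy using glue_of_lt _ _ hy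

lemma energy_glue (e : ℝ≥0 → ℝ≥0∞) (f g : ℝ → ℝ) (c : ℝ) :
    energy e (glue c f g) =
      (∫⁻ x in Iic c, energyDensity e f x) + ∫⁻ x in Ioi c, energyDensity e g x := by
  rw [energy_eq_lintegral, ← lintegral_add_compl _ (measurableSet_Iic (a := c)), compl_Iic,
    setLIntegral_energyDensity_glue_Iic e le_rfl, setLIntegral_energyDensity_glue_Ioi e le_rfl]

lemma setLIntegral_Ioi_comp_add_right (F : ℝ → ℝ≥0∞) (a d : ℝ) :
    ∫⁻ x in Ioi a, F (x + d) = ∫⁻ x in Ioi (a + d), F x := by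
  have := (measurePreserving_add_right (volume : Measure ℝ) d).setLIntegral_comp_preimage_emb
    (Homeomorph.addRight d).isClosedEmbedding.measurableEmbedding F (Ioi (a + d))
  simpa using this

lemma setLIntegral_Iic_comp_add_right (F : ℝ → ℝ≥0∞) (a d : ℝ) :
    ∫⁻ x in Iic a, F (x + d) = ∫⁻ x in Iic (a + d), F x := by
  have := (measurePreserving_add_right (volume : Measure ℝ) d).setLIntegral_comp_preimage_emb
    (Homeomorph.addRight d).isClosedEmbedding.measurableEmbedding F (Iic (a + d))
  simpa using this

lemma setLIntegral_Ioi_comp_sub_left (F : ℝ → ℝ≥0∞) (a d : ℝ) :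
    ∫⁻ x in Ioi a, F (d - x) = ∫⁻ x in Iio (d - a), F x := by
  have := (volume.measurePreserving_sub_left d).setLIntegral_comp_preimage_emb
    (Homeomorph.subLeft d).isClosedEmbedding.measurableEmbedding F (Iio (d - a))
  simpa using this

lemma setIntegral_Ioi_comp_add_right (F : ℝ → ℝ) (a d : ℝ) :
    ∫ x in Ioi a, F (x + d) = ∫ x in Ioi (a + d), F x := by
  have := (measurePreserving_add_right (volume : Measure ℝ) d).setIntegral_preimage_emb
    (Homeomorph.addRight d).isClosedEmbedding.measurableEmbedding F (Ioi (a + d))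
  simpa using this

/-! ### Inserting a plateau and excising mass -/

/-- A plateau of mass `δ` can be inserted at any positive value of a phase field. -/
lemma exists_plateau (e : ℝ≥0 → ℝ≥0∞) {ψ : ℝ → ℝ} {w : ℝ≥0} (h : IsPhaseField ψ w) {a : ℝ}
    (ha : 0 < ψ a) (δ : ℝ≥0) :
    ∃ ψ', IsPhaseField ψ' (w + δ) ∧
      energy e ψ' = energy e ψ + ENNReal.ofReal (δ / ψ a) * e ‖ψ a‖₊ := by
  have hac : LocAbsCont ψ := h.absCont
  set ℓ : ℝ := δ / ψ a with hℓ
  have hℓ0 : 0 ≤ ℓ := by positivity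
  set q : ℝ → ℝ := glue (a + ℓ) (fun _ => ψ a) (fun x => ψ (x + -ℓ)) with hq
  have hqac : LocAbsCont q := by
    refine (LocAbsCont.const _).glue (hac.comp_add_right _) ?_
    simp
  have hqa : q a = ψ a := glue_of_le _ _ (by linarith)
  have hqle : ∀ x ∈ Ioc a (a + ℓ), q x = ψ a := fun x hx => glue_of_le _ _ hx.2
  have hqgt : ∀ x ∈ Ioi (a + ℓ), q x = ψ (x + -ℓ) := fun x hx => glue_of_lt _ _ hx
  have hsplit : Ioi a = Ioc a (a + ℓ) ∪ Ioi (a + ℓ) := (Ioc_union_Ioi_eq_Ioi (by linarith)).symm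
  have hdisj : Disjoint (Ioc a (a + ℓ)) (Ioi (a + ℓ)) :=
    disjoint_left.2 fun x hx hx' => absurd hx.2 (not_le.2 hx')
  have hint1 : IntegrableOn q (Ioc a (a + ℓ)) :=
    (hqac.continuous.integrableOn_Icc).mono_set Ioc_subset_Icc_self
  have hint2 : IntegrableOn q (Ioi (a + ℓ)) := by
    exact IntegrableOn.congr_fun (h.integrable.comp_add_right (-ℓ)).integrableOn
      (fun x hx => (hqgt x hx).symm) measurableSet_Ioi
  have hqint : IntegrableOn q (Ioi a) := by
    rw [hsplit]; exact hint1.union hint2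
  refine ⟨glue a ψ q, ⟨(hac.glue hqac hqa.symm : LocAbsCont _),
    integrable_glue h.integrable.integrableOn hqint, ?_⟩, ?_⟩
  · rw [integral_glue h.integrable.integrableOn hqint, hsplit,
      setIntegral_union hdisj measurableSet_Ioi hint1 hint2,
      setIntegral_congr_fun measurableSet_Ioc hqle, setIntegral_congr_fun measurableSet_Ioi hqgt,
      setIntegral_Ioi_comp_add_right]
    have h1 := integral_add_compl (measurableSet_Iic (a := a)) h.integrable
    rw [compl_Iic, h.mass] at h1
    have h2 : ℓ * ψ a = δ := by rw [hℓ]; field_simp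
    simp only [integral_const, MeasurableSet.univ, measureReal_restrict_apply, univ_inter,
      Real.volume_real_Ioc_of_le (show a ≤ a + ℓ by linarith), smul_eq_mul, add_sub_cancel_left,
      add_neg_cancel_right, h2, NNReal.coe_add]
    linarith
  · rw [energy_glue, hsplit, lintegral_union measurableSet_Ioi hdisj,
      setLIntegral_energyDensity_glue_Ioi e le_rfl, setLIntegral_congr Ioo_ae_eq_Ioc.symm,
      setLIntegral_congr_fun (g := fun _ => e ‖ψ a‖₊) measurableSet_Ioo]
    · simp only [energyDensity_comp_add, lintegral_const, MeasurableSet.univ,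
        Measure.restrict_apply, univ_inter, Real.volume_Ioo, add_sub_cancel_left]
      rw [setLIntegral_Ioi_comp_add_right (energyDensity e ψ), add_neg_cancel_right,
        energy_eq_lintegral, ← lintegral_add_compl (μ := volume) _ (measurableSet_Iic (a := a)),
        compl_Iic]
      ring
    · intro x hx
      dsimp only
      rw [← energyDensity_const e (ψ a) x]
      refine energyDensity_congr e ?_
      filter_upwards [Iio_mem_nhds hx.2] with y hy using glue_of_le _ _ (le_of_lt hy)

/-- The part of a phase field over an interval with equal values at both ends can be cut out. The
resulting profile takes no new values, so that nonnegativity is preserved. -/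
lemma exists_excision (e : ℝ≥0 → ℝ≥0∞) {ψ : ℝ → ℝ} {w w' : ℝ≥0} (h : IsPhaseField ψ w) {a b : ℝ}
    (hab : a ≤ b) (hψ : ψ a = ψ b) (hw : w' + ∫ x in Ioc a b, ψ x = w) :
    ∃ ψ', IsPhaseField ψ' w' ∧
      energy e ψ' + ∫⁻ x in Ioc a b, energyDensity e ψ x = energy e ψ ∧
      ∀ y, ∃ x, ψ' y = ψ x := by
  have hac : LocAbsCont ψ := h.absCont
  have hsplit : Ioi a = Ioc a b ∪ Ioi b := (Ioc_union_Ioi_eq_Ioi hab).symm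
  have hdisj : Disjoint (Ioc a b) (Ioi b) :=
    disjoint_left.2 fun x hx hx' => absurd hx.2 (not_le.2 hx')
  have hi : IntegrableOn (fun x => ψ (x + (b - a))) (Ioi a) :=
    (h.integrable.comp_add_right (b - a)).integrableOn
  refine ⟨glue a ψ (fun x => ψ (x + (b - a))),
    ⟨(hac.glue (hac.comp_add_right _) (by simpa using hψ) : LocAbsCont _),
      integrable_glue h.integrable.integrableOn hi, ?_⟩, ?_, fun y => ?_⟩
  · rw [integral_glue h.integrable.integrableOn hi, setIntegral_Ioi_comp_add_right,
      add_sub_cancel]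
    have h1 := integral_add_compl (measurableSet_Iic (a := a)) h.integrable
    rw [compl_Iic, h.mass, hsplit, setIntegral_union hdisj measurableSet_Ioi
      h.integrable.integrableOn h.integrable.integrableOn] at h1
    linarith
  · rw [energy_glue]
    simp only [energyDensity_comp_add]
    rw [setLIntegral_Ioi_comp_add_right (energyDensity e ψ), add_sub_cancel,
      energy_eq_lintegral, ← lintegral_add_compl (μ := volume) _ (measurableSet_Iic (a := a)),
        compl_Iic, hsplit,
      lintegral_union measurableSet_Ioi hdisj]
    ring
  · rcases le_or_gt y a with hy | hy
    · exact ⟨y, glue_of_le _ _ hy⟩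
    · exact ⟨_, glue_of_lt _ _ hy⟩

/-- A shortest interval carrying the mass `δ` has equal values of the (continuous) density at its
two ends: sliding it sideways cannot increase the mass. -/
lemma exists_interval_of_mass {ψ : ℝ → ℝ} (hc : Continuous ψ) (h0 : ∀ x, 0 ≤ ψ x)
    (hi : Integrable ψ) {δ : ℝ} (hδ : 0 < δ) (hδw : δ < ∫ x, ψ x) :
    ∃ a b, a ≤ b ∧ ψ a = ψ b ∧ ∫ x in Ioc a b, ψ x = δ := by
  set w := ∫ x, ψ x with hw
  set Φ : ℝ → ℝ := fun x => ∫ s in (0 : ℝ)..x, ψ s with hΦ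
  have hii : ∀ a b, IntervalIntegrable ψ volume a b := fun a b => hc.intervalIntegrable a b
  have hder : ∀ x, HasDerivAt Φ (ψ x) x := fun x =>
    intervalIntegral.integral_hasDerivAt_right (hii 0 x) (hc.stronglyMeasurableAtFilter _ _)
      hc.continuousAt
  have hΦc : Continuous Φ := continuous_iff_continuousAt.2 fun x => (hder x).continuousAt
  have hsub : ∀ a b, Φ b - Φ a = ∫ s in a..b, ψ s := fun a b =>
    intervalIntegral.integral_interval_sub_left (hii 0 b) (hii 0 a)
  have hmono : Monotone Φ := fun a b hab => by
    have : 0 ≤ Φ b - Φ a := by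
      rw [hsub]; exact intervalIntegral.integral_nonneg hab fun x _ => h0 x
    linarith
  have htot : ∀ a b, Φ b - Φ a ≤ w := fun a b => by
    rcases le_total a b with hab | hab
    · rw [hsub, intervalIntegral.integral_of_le hab]
      exact setIntegral_le_integral hi (Eventually.of_forall h0)
    · linarith [hmono hab]
  -- almost all of the mass lies in `[-R, R]`
  obtain ⟨R, hR0, hR1, hR2⟩ : ∃ R : ℝ, 0 < R ∧ δ < Φ R - Φ (-R) ∧ w - δ < Φ R - Φ (-R) := by
    have ht : Tendsto (fun R : ℝ => Φ R - Φ (-R)) atTop (𝓝 w) := by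
      simp only [hsub]
      exact intervalIntegral_tendsto_integral hi tendsto_neg_atTop_atBot tendsto_id
    obtain ⟨R, h1, h2, h3⟩ := ((eventually_gt_atTop 0).and ((ht.eventually_const_lt hδw).and
      (ht.eventually_const_lt (show w - δ < w by linarith)))).exists
    exact ⟨R, h1, h2, h3⟩
  have hbd : ∀ a b, δ ≤ Φ b - Φ a → a ≤ R ∧ -R ≤ b := fun a b hab => by
    constructor
    · by_contra! hcon
      linarith [hmono hcon.le, htot (-R) b]
    · by_contra! hcon
      linarith [hmono hcon.le, htot a R]
  set K : Set (ℝ × ℝ) := (Icc (-(3 * R)) R ×ˢ Icc (-R) (3 * R)) ∩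
    ({p | p.1 ≤ p.2} ∩ {p | δ ≤ Φ p.2 - Φ p.1}) with hK
  have hKc : IsCompact K := by
    refine (isCompact_Icc.prod isCompact_Icc).inter_right ?_
    exact (isClosed_le continuous_fst continuous_snd).inter
      (isClosed_le continuous_const (by fun_prop))
  have hKn : (-R, R) ∈ K :=
    ⟨⟨⟨by linarith, by linarith⟩, by linarith, by linarith⟩,
      show -R ≤ R by linarith, hR1.le⟩
  obtain ⟨⟨a, b⟩, hab, hmin⟩ := hKc.exists_isMinOn ⟨_, hKn⟩
    (f := fun p : ℝ × ℝ => p.2 - p.1) (by fun_prop)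
  have hle : a ≤ b := hab.2.1
  have hge : δ ≤ Φ b - Φ a := hab.2.2
  have hL : b - a ≤ 2 * R := by
    have := hmin hKn
    simp only [mem_ofPred_eq] at this
    linarith
  -- a heavier interval of the same length would contain a shorter one of mass `δ`
  have key : ∀ x, Φ (x + (b - a)) - Φ x ≤ δ := by
    intro x
    by_contra! hcon
    obtain ⟨ℓ, ⟨hℓ0, hℓ1⟩, hℓ⟩ := intermediate_value_Icc (sub_nonneg.2 hle)
      (f := fun ℓ => Φ (x + ℓ) - Φ x) (by fun_prop)
      (show δ ∈ Icc (Φ (x + 0) - Φ x) (Φ (x + (b - a)) - Φ x) from ⟨by simpa using hδ.le, hcon.le⟩)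
    dsimp only at hℓ
    have hne : ℓ ≠ b - a := fun hh => by rw [hh] at hℓ; linarith
    have hlt : ℓ < b - a := lt_of_le_of_ne hℓ1 hne
    obtain ⟨h1, h2⟩ := hbd x (x + ℓ) hℓ.ge
    have hmem : (x, x + ℓ) ∈ K :=
      ⟨⟨⟨by linarith, h1⟩, h2, by linarith⟩, show x ≤ x + ℓ by linarith, hℓ.ge⟩
    have := hmin hmem
    simp only [mem_ofPred_eq] at this
    linarith
  have heq : Φ b - Φ a = δ := le_antisymm (by simpa using key a) hge
  refine ⟨a, b, hle, ?_, ?_⟩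
  · have hmax : IsLocalMax (fun x => Φ (x + (b - a)) - Φ x) a :=
      Eventually.of_forall fun x => by simpa [heq] using key x
    have hd : HasDerivAt (fun x => Φ (x + (b - a)) - Φ x) (ψ b - ψ a) a := by
      have h1 := (hder (a + (b - a))).comp_add_const a (b - a)
      rw [add_sub_cancel] at h1
      exact h1.sub (hder a)
    linarith [hmax.hasDerivAt_eq_zero hd]
  · rw [← intervalIntegral.integral_of_le hle, ← hsub, heq]

/-- Cutting mass `δ` out of a nonnegative phase field bounded by `M` saves at least `δ z(M)`. -/
lemma exists_remove_mass {z : ℝ≥0 → ℝ≥0∞} (hz : Antitone z) {ψ : ℝ → ℝ} {w : ℝ≥0}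
    (h : IsPhaseField ψ w) (h0 : ∀ x, 0 ≤ ψ x) {w' δ : ℝ≥0} (hw : w' + δ = w) (hw' : 0 < w') :
    ∃ ψ', IsPhaseField ψ' w' ∧ (∀ x, 0 ≤ ψ' x) ∧
      energy (phaseFieldCost z) ψ' ≤ energy (phaseFieldCost z) ψ ∧
      ∀ M : ℝ≥0, (∀ x, ψ x ≤ M) →
        energy (phaseFieldCost z) ψ' + δ * z M ≤ energy (phaseFieldCost z) ψ := by
  rcases eq_or_ne δ 0 with rfl | hδ
  · obtain rfl : w' = w := by simpa using hw
    exact ⟨ψ, h, h0, le_rfl, fun M _ => by simp⟩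
  have hδ' : (0 : ℝ) < δ := by positivity
  have hwr : (w' : ℝ) + δ = w := by exact_mod_cast hw
  have hw'r : (0 : ℝ) < w' := hw'
  obtain ⟨a, b, hab, hψ, hm⟩ := exists_interval_of_mass
    (LocAbsCont.continuous h.absCont) h0 h.integrable hδ' (by rw [h.mass]; linarith)
  obtain ⟨ψ', h1, h2, h3⟩ := exists_excision (w' := w') (phaseFieldCost z) h hab hψ (by linarith)
  refine ⟨ψ', h1, fun x => ?_, h2 ▸ le_self_add, fun M hM => ?_⟩
  · obtain ⟨y, hy⟩ := h3 x
    rw [hy]; exact h0 y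
  · rw [← h2]
    gcongr
    have h4 : (δ : ℝ≥0∞) = ∫⁻ x in Ioc a b, ENNReal.ofReal (ψ x) := by
      rw [← ofReal_integral_eq_lintegral_ofReal h.integrable.integrableOn
        (Eventually.of_forall h0), hm]
      simp
    -- on the excised interval the density is at least `c(ψ) = ψ z(ψ) ≥ z(M) ψ`
    rw [h4, mul_comm, ← lintegral_const_mul]
    · refine lintegral_mono fun x => ?_
      have h5 : ‖ψ x‖₊ ≤ M := by
        rw [← NNReal.coe_le_coe, coe_nnnorm, Real.norm_of_nonneg (h0 x)]; exact hM x
      have h6 : ENNReal.ofReal (ψ x) = ‖ψ x‖₊ := by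
        rw [← Real.enorm_eq_ofReal (h0 x)]; rfl
      rw [energyDensity, phaseFieldCost, h6, mul_comm]
      exact le_add_left (by gcongr; exact hz h5)
    · exact (LocAbsCont.continuous h.absCont).measurable.ennreal_ofReal

/-- At a zero of `ψ` the derivatives of `|ψ|` and `ψ` may differ, but difference quotients show
`||ψ|'| ≤ |ψ'|` wherever both exist. -/
lemma energy_abs_le (e : ℝ≥0 → ℝ≥0∞) {ψ : ℝ → ℝ} (h : LocAbsCont ψ) :
    energy e (fun x => |ψ x|) ≤ energy e ψ := by
  refine lintegral_mono_ae ?_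
  filter_upwards [h.ae_differentiableAt, h.abs.ae_differentiableAt] with x h1 h2
  have : |deriv (fun x => |ψ x|) x| ≤ |deriv ψ x| := by
    have h3 : ∀ᶠ y in 𝓝 x, ‖|ψ y| - |ψ x|‖ ≤ ‖ψ y - ψ x‖ :=
      Eventually.of_forall fun y => by
        simpa [Real.norm_eq_abs] using abs_abs_sub_abs_le (ψ y) (ψ x)
    have h4 := h2.hasDerivAt.tendsto_slope.norm
    have h5 := h1.hasDerivAt.tendsto_slope.norm
    refine le_of_tendsto_of_tendsto h4 h5 (Eventually.of_forall fun y => ?_)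
    simp only [slope_def_field, Real.norm_eq_abs, abs_div]
    gcongr ?_ / _
    exact abs_abs_sub_abs_le (ψ y) (ψ x)
  have h6 : ‖|ψ x|‖₊ = ‖ψ x‖₊ := by ext; simp
  rw [h6]
  gcongr

lemma isPhaseField_zero : IsPhaseField (fun _ => 0) 0 :=
  ⟨LocAbsCont.const 0, integrable_zero _ _ _, by simp⟩

lemma energy_zero (z : ℝ≥0 → ℝ≥0∞) : energy (phaseFieldCost z) (fun _ => 0) = 0 := by
  simp [energy, phaseFieldCost]

lemma tauOf_le {z : ℝ≥0 → ℝ≥0∞} {ψ : ℝ → ℝ} {w : ℝ≥0} (h : IsPhaseField ψ w) :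
    tauOf z w ≤ energy (phaseFieldCost z) ψ := by
  unfold tauOf inducedCost
  exact iInf₂_le ψ h

lemma tauOf_zero (z : ℝ≥0 → ℝ≥0∞) : tauOf z 0 = 0 :=
  le_antisymm ((tauOf_le isPhaseField_zero).trans (energy_zero z).le) zero_le

/-- Passing to the absolute value and cutting out the surplus mass, phase fields may be taken
nonnegative. -/
lemma exists_nonneg_energy_lt {z : ℝ≥0 → ℝ≥0∞} (hz : Antitone z) {w : ℝ≥0} (hw : 0 < w)
    {E : ℝ≥0∞} (hE : tauOf z w < E) :
    ∃ ψ, IsPhaseField ψ w ∧ (∀ x, 0 ≤ ψ x) ∧ energy (phaseFieldCost z) ψ < E := by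
  simp only [tauOf, inducedCost, iInf_lt_iff] at hE
  obtain ⟨ψ, h, hlt⟩ := hE
  have hac : LocAbsCont ψ := h.absCont
  have hnn : 0 ≤ ∫ x, |ψ x| := integral_nonneg fun x => abs_nonneg _
  have habs : IsPhaseField (fun x => |ψ x|) (∫ x, |ψ x|).toNNReal :=
    ⟨hac.abs, h.integrable.abs, by rw [Real.coe_toNNReal _ hnn]⟩
  have hle : w ≤ (∫ x, |ψ x|).toNNReal := by
    rw [← NNReal.coe_le_coe, Real.coe_toNNReal _ hnn, ← h.mass]
    exact integral_mono h.integrable h.integrable.abs fun x => le_abs_self _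
  obtain ⟨ψ', h1, h2, h3, -⟩ := exists_remove_mass hz habs (fun x => abs_nonneg _)
    (add_tsub_cancel_of_le hle) hw
  exact ⟨ψ', h1, h2, (h3.trans (energy_abs_le _ hac)).trans_lt hlt⟩

/-- The cost is nondecreasing, as excising mass does not increase the energy. -/
lemma tauOf_mono {z : ℝ≥0 → ℝ≥0∞} (hz : Antitone z) : Monotone (tauOf z) := by
  intro w' w hw
  rcases eq_or_ne w' 0 with rfl | hw0
  · rw [tauOf_zero]; exact zero_le
  refine le_of_forall_gt fun E hE => ?_
  obtain ⟨ψ, h1, h2, h3⟩ := exists_nonneg_energy_lt hz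
    (lt_of_lt_of_le (pos_iff_ne_zero.2 hw0) hw) hE
  obtain ⟨ψ', h4, -, h5, -⟩ := exists_remove_mass hz h1 h2 (add_tsub_cancel_of_le hw)
    (pos_iff_ne_zero.2 hw0)
  exact ((tauOf_le h4).trans h5).trans_lt h3

/-! ### Decay at infinity and the crossing estimate -/

/-- A uniformly continuous integrable function vanishes at infinity. -/
lemma tendsto_zero_of_uniformContinuous_of_integrable {f : ℝ → ℝ} (hu : UniformContinuous f)
    (hi : Integrable f) : Tendsto f (cocompact ℝ) (𝓝 0) := by
  have hc := hu.continuous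
  set Φ : ℝ → ℝ := fun x => ∫ s in (0 : ℝ)..x, |f s|
  have hii : ∀ a b, IntervalIntegrable (fun x => |f x|) volume a b :=
    fun a b => hc.abs.intervalIntegrable a b
  have hsub : ∀ a b, Φ b - Φ a = ∫ s in a..b, |f s| := fun a b =>
    intervalIntegral.integral_interval_sub_left (hii 0 b) (hii 0 a)
  have htop : ∃ l, Tendsto Φ atTop (𝓝 l) :=
    ⟨_, intervalIntegral_tendsto_integral_Ioi 0 hi.abs.integrableOn tendsto_id⟩
  have hbot : ∃ l, Tendsto Φ atBot (𝓝 l) := by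
    refine ⟨_, (intervalIntegral_tendsto_integral_Iic 0 hi.abs.integrableOn tendsto_id).neg.congr
      fun x => ?_⟩
    exact (intervalIntegral.integral_symm _ _).symm
  rw [Metric.uniformContinuous_iff] at hu
  rw [Metric.tendsto_nhds]
  intro ε hε
  obtain ⟨d, hd, hud⟩ := hu (ε / 2) (by positivity)
  -- a value of size `ε` at `x` forces `∫ |f| ≥ d ε / 2` over `[x, x + d]`
  have key : ∀ x, Φ (x + d) - Φ x < d * (ε / 2) → dist (f x) 0 < ε := by
    intro x hx
    by_contra! hcon
    rw [Real.dist_eq, sub_zero] at hcon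
    have : ∫ _s in x..(x + d), ε / 2 ≤ ∫ s in x..(x + d), |f s| := by
      refine intervalIntegral.integral_mono_on_of_le_Ioo (by linarith) (by simp) (hii _ _)
        fun s hs => ?_
      have h1 := hud (a := s) (b := x) (by
        rw [Real.dist_eq, abs_lt]; constructor <;> linarith [hs.1, hs.2])
      rw [Real.dist_eq] at h1
      have := abs_sub_abs_le_abs_sub (f x) (f s)
      rw [abs_sub_comm (f s)] at h1
      linarith
    rw [← hsub] at this
    simp at this
    linarith
  have hpos : 0 < d * (ε / 2) := by positivity
  rw [cocompact_eq_atBot_atTop]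
  refine eventually_sup.2 ⟨?_, ?_⟩
  · obtain ⟨l, hl⟩ := hbot
    have : Tendsto (fun x => Φ (x + d) - Φ x) atBot (𝓝 0) := by
      simpa using (hl.comp (tendsto_atBot_add_const_right _ d tendsto_id)).sub hl
    filter_upwards [this.eventually_lt_const hpos] with x hx using key x hx
  · obtain ⟨l, hl⟩ := htop
    have : Tendsto (fun x => Φ (x + d) - Φ x) atTop (𝓝 0) := by
      simpa using (hl.comp (tendsto_atTop_add_const_right _ d tendsto_id)).sub hl
    filter_upwards [this.eventually_lt_const hpos] with x hx using key x hx

/-- A locally absolutely continuous function with square integrable derivative is uniformly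
continuous. -/
lemma LocAbsCont.uniformContinuous {f : ℝ → ℝ} (hf : LocAbsCont f)
    (h2 : Integrable fun x => deriv f x ^ 2) : UniformContinuous f := by
  set D := ∫ x, deriv f x ^ 2 with hD
  have hD0 : 0 ≤ D := integral_nonneg fun x => sq_nonneg _
  have key : ∀ κ > 0, ∀ x y, x ≤ y → |f y - f x| ≤ κ * (y - x) + D / κ := by
    intro κ hκ x y hxy
    rw [← hf.integral_deriv]
    calc |∫ s in x..y, deriv f s| ≤ ∫ s in x..y, |deriv f s| :=
          intervalIntegral.abs_integral_le_integral_abs hxy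
      _ ≤ ∫ s in x..y, (κ + deriv f s ^ 2 / κ) := by
          refine intervalIntegral.integral_mono_on hxy (hf.intervalIntegrable_deriv x y).abs
            ((by simp : IntervalIntegrable (fun _ => κ) volume x y).add
              (h2.intervalIntegrable.div_const κ)) fun s _ => ?_
          rw [← sq_abs (deriv f s), ← sub_nonneg]
          have : κ + |deriv f s| ^ 2 / κ - |deriv f s|
              = ((κ - |deriv f s| / 2) ^ 2 + 3 / 4 * |deriv f s| ^ 2) / κ := by
            field_simp; ring
          rw [this]; positivity
      _ ≤ κ * (y - x) + D / κ := by
          rw [intervalIntegral.integral_add (by simp) (h2.intervalIntegrable.div_const κ),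
            intervalIntegral.integral_const, smul_eq_mul, mul_comm,
            intervalIntegral.integral_div, intervalIntegral.integral_of_le hxy]
          gcongr
          exact setIntegral_le_integral h2 (Eventually.of_forall fun x => sq_nonneg _)
  rw [Metric.uniformContinuous_iff]
  intro ε hε
  -- `κ` makes the second term of the estimate smaller than `ε / 2`
  set κ := 2 * (D + 1) / ε with hκ
  have hκ0 : 0 < κ := by positivity
  have h3 : D / κ < ε / 2 := by
    rw [hκ, div_lt_iff₀ (by positivity)]; field_simp; linarith
  refine ⟨ε / (2 * κ), by positivity, fun {x y} hxy => ?_⟩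
  wlog h : x ≤ y generalizing x y
  · rw [dist_comm]; exact this (by rwa [dist_comm]) (le_of_not_ge h)
  rw [Real.dist_eq, abs_sub_comm] at hxy ⊢
  rw [abs_of_nonneg (by linarith), lt_div_iff₀ (by positivity)] at hxy
  linarith [key κ hκ0 x y h]

/-- Phase fields of finite energy vanish at infinity, since `ψ ∈ L¹` and `ψ' ∈ L²`. -/
lemma IsPhaseField.tendsto_zero {ψ : ℝ → ℝ} {w : ℝ≥0} (h : IsPhaseField ψ w) {e : ℝ≥0 → ℝ≥0∞}
    (he : energy e ψ ≠ ⊤) : Tendsto ψ (cocompact ℝ) (𝓝 0) := by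
  refine tendsto_zero_of_uniformContinuous_of_integrable
    (LocAbsCont.uniformContinuous h.absCont ?_) h.integrable
  have hm : Measurable (deriv ψ) := measurable_deriv ψ
  have h1 : ∫⁻ y, ENNReal.ofReal ((1 / 2) * |deriv ψ y| ^ 2) ≠ ⊤ :=
    ne_top_of_le_ne_top he (lintegral_mono fun y => le_self_add)
  have h2 : Integrable fun y => (1 / 2) * |deriv ψ y| ^ 2 :=
    (lintegral_ofReal_ne_top_iff_integrable (by fun_prop)
      (Eventually.of_forall fun y => by positivity)).1 h1
  convert h2.const_mul 2 using 2 with y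
  rw [sq_abs]; ring

/-- The fundamental theorem of calculus for a nonnegative derivative, as a Lebesgue integral. -/
lemma lintegral_Ioo_ofReal_deriv {f f' : ℝ → ℝ} {a b : ℝ} (hab : a ≤ b)
    (hc : ContinuousOn f (Icc a b)) (hd : ∀ x ∈ Ioo a b, HasDerivAt f (f' x) x)
    (h0 : ∀ x ∈ Ioo a b, 0 ≤ f' x) :
    ∫⁻ x in Ioo a b, ENNReal.ofReal (f' x) = ENNReal.ofReal (f b - f a) := by
  have hi : IntegrableOn f' (Ioc a b) := intervalIntegral.integrableOn_deriv_of_nonneg hc hd h0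
  rw [← intervalIntegral.integral_eq_sub_of_hasDerivAt_of_le hab hc hd
    ((intervalIntegrable_iff_integrableOn_Ioc_of_le hab).2 hi),
    intervalIntegral.integral_of_le hab, integral_Ioc_eq_integral_Ioo,
    ofReal_integral_eq_lintegral_ofReal (hi.mono_set Ioo_subset_Ioc_self)]
  exact (ae_restrict_iff' measurableSet_Ioo).2 (Eventually.of_forall h0)

lemma lintegral_Ioo_inv_sqrt (t b : ℝ) :
    ∫⁻ s in Ioo t b, ENNReal.ofReal (1 / (2 * √(s - t))) = ENNReal.ofReal (√(b - t)) := by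
  rcases le_or_gt b t with h | h
  · rw [Ioo_eq_empty (not_lt.2 h), Real.sqrt_eq_zero_of_nonpos (by linarith)]; simp
  · rw [lintegral_Ioo_ofReal_deriv (f := fun s => √(s - t)) h.le (by fun_prop)
      (fun x hx => ((hasDerivAt_id' x).sub_const t).sqrt (by simp; linarith [hx.1]))
      (fun x _ => by positivity)]
    simp

lemma hasDerivAt_rpow_three_halves (x : ℝ) :
    HasDerivAt (fun x : ℝ => 2 * √2 / 3 * x ^ (3 / 2 : ℝ)) (√(2 * x)) x := by
  have h := (Real.hasDerivAt_rpow_const (x := x) (p := 3 / 2) (Or.inr (by norm_num))).const_mul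
    (2 * √2 / 3)
  refine h.congr_deriv ?_
  rw [Real.sqrt_mul (by norm_num), Real.sqrt_eq_rpow x]
  norm_num
  ring

lemma lintegral_Ioo_sqrt {b : ℝ} (hb : 0 ≤ b) :
    ∫⁻ x in Ioo 0 b, ENNReal.ofReal (√(2 * x))
      = ENNReal.ofReal (2 * √2 / 3 * b ^ (3 / 2 : ℝ)) := by
  rw [lintegral_Ioo_ofReal_deriv (f := fun x : ℝ => 2 * √2 / 3 * x ^ (3 / 2 : ℝ)) hb
    (fun x _ => (hasDerivAt_rpow_three_halves x).continuousAt.continuousWithinAt)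
    (fun x _ => hasDerivAt_rpow_three_halves x) (fun x _ => Real.sqrt_nonneg _)]
  rw [Real.zero_rpow (by norm_num)]; simp

/-- The increment of a locally absolutely continuous function is bounded by the integral of any
majorant `D` of its derivative, measurable or not. -/
lemma LocAbsCont.ofReal_abs_sub_le {f : ℝ → ℝ} (hf : LocAbsCont f) {D : ℝ → ℝ≥0∞}
    (hD : ∀ᵐ x, ENNReal.ofReal |deriv f x| ≤ D x) (a b : ℝ) (hab : a ≤ b) :
    ENNReal.ofReal |f b - f a| ≤ ∫⁻ x in Ioc a b, D x := by
  rw [← hf.integral_deriv]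
  calc ENNReal.ofReal |∫ s in a..b, deriv f s|
      ≤ ENNReal.ofReal (∫ s in a..b, |deriv f s|) :=
        ENNReal.ofReal_le_ofReal (intervalIntegral.abs_integral_le_integral_abs hab)
    _ = ∫⁻ s in Ioc a b, ENNReal.ofReal |deriv f s| := by
        rw [intervalIntegral.integral_of_le hab, ofReal_integral_eq_lintegral_ofReal]
        · exact (hf.intervalIntegrable_deriv a b).1.abs
        · exact Eventually.of_forall fun x => abs_nonneg _
    _ ≤ _ := lintegral_mono_ae (ae_restrict_of_ae hD)

/-- A profile that vanishes at infinity and reaches the height `m` passes through all levels below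
`m` at least twice. The estimate is the fundamental theorem of calculus for `G(ψ)` on both sides of
`p`, where `G(x) = 2√2/3 min(x, m)^{3/2}` is the primitive of `√(2 x)` truncated at `m`. -/
lemma le_lintegral_deriv_mul_sqrt {ψ : ℝ → ℝ} (hψ : LocAbsCont ψ) (h0 : ∀ y, 0 ≤ ψ y)
    (ht : Tendsto ψ (cocompact ℝ) (𝓝 0)) {p m : ℝ}
    (hm0 : 0 ≤ m) (hm : m ≤ ψ p) :
    ENNReal.ofReal (2 * (2 * √2 / 3 * m ^ (3 / 2 : ℝ))) ≤
      ∫⁻ y in {y | ψ y < m}, ENNReal.ofReal (|deriv ψ y| * √(2 * ψ y)) := by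
  classical
  set P : ℝ → ℝ := fun x => 2 * √2 / 3 * x ^ (3 / 2 : ℝ) with hP
  have hPmono : ∀ x y, 0 ≤ x → x ≤ y → P x ≤ P y := fun x y hx hxy => by
    simp only [hP]; gcongr
  have hPcd : ContDiff ℝ 1 P :=
    contDiff_const.mul (Real.contDiff_rpow_const_of_le (by norm_num))
  have hP0 : P 0 = 0 := by simp [hP]
  obtain ⟨K, hK⟩ := hPcd.contDiffOn.exists_lipschitzOnWith (s := Icc 0 m) (by decide)
    (convex_Icc _ _) isCompact_Icc
  have hmin : LipschitzWith 1 (fun x : ℝ => min x m) := LipschitzWith.id.min_const m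
  set G : ℝ → ℝ := fun x => P (min x m) with hG
  have hGlip : LipschitzOnWith (K * 1) G (range ψ) :=
    hK.comp (hmin.lipschitzOnWith) (by
      rintro _ ⟨y, rfl⟩
      exact ⟨le_min (h0 y) hm0, min_le_right _ _⟩)
  have hf : LocAbsCont fun y => G (ψ y) := hψ.comp_lipschitzOn hGlip
  set D : ℝ → ℝ≥0∞ := {y | ψ y < m}.indicator
    fun y => ENNReal.ofReal (|deriv ψ y| * √(2 * ψ y)) with hD
  have hSm : MeasurableSet {y | ψ y < m} :=
    measurableSet_lt hψ.continuous.measurable measurable_const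
  have hae : ∀ᵐ y, ENNReal.ofReal |deriv (fun y => G (ψ y)) y| ≤ D y := by
    filter_upwards [hψ.ae_differentiableAt] with y h1
    by_cases hy : ψ y < m
    · have h2 : (fun y => G (ψ y)) =ᶠ[𝓝 y] fun y => P (ψ y) := by
        filter_upwards [hψ.continuous.continuousAt.eventually_lt_const hy] with x hx
        simp only [hG, min_eq_left hx.le]
      have h3 : deriv (fun y => P (ψ y)) y = √(2 * ψ y) * deriv ψ y :=
        ((hasDerivAt_rpow_three_halves _).comp y h1.hasDerivAt).deriv
      rw [h2.deriv_eq, h3, hD,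
        indicator_of_mem (show y ∈ {y | ψ y < m} from hy), abs_mul, mul_comm,
        abs_of_nonneg (Real.sqrt_nonneg _)]
    -- where `ψ ≥ m` the function `G(ψ)` attains its maximum, so its derivative vanishes
    · have h2 : IsLocalMax (fun y => G (ψ y)) y := Eventually.of_forall fun x => by
        simp only [hG, min_eq_right (not_lt.1 hy)]
        exact hPmono _ _ (le_min (h0 x) hm0) (min_le_right _ _)
      rw [h2.deriv_eq_zero]; simp
  have hGm : G (ψ p) = P m := by simp only [hG, min_eq_right hm]
  have hPm : 0 ≤ P m := by simp only [hP]; positivity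
  have htG : Tendsto (fun y => G (ψ y)) (cocompact ℝ) (𝓝 0) := by
    have : Tendsto G (𝓝 0) (𝓝 (G 0)) :=
      (hPcd.continuous.comp hmin.continuous).tendsto 0
    rw [show G 0 = 0 by simp only [hG, min_eq_left hm0, hP0]] at this
    exact this.comp ht
  have hlim : ∀ l ≤ cocompact ℝ, Tendsto (fun y => ENNReal.ofReal |G (ψ p) - G (ψ y)|) l
      (𝓝 (ENNReal.ofReal (P m))) := fun l hl => by
    have := ENNReal.tendsto_ofReal ((tendsto_const_nhds (x := G (ψ p))).sub (htG.mono_left hl)).abs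
    rw [hGm] at this ⊢
    rwa [sub_zero, abs_of_nonneg hPm] at this
  have hleft : ENNReal.ofReal (P m) ≤ ∫⁻ y in Iic p, D y := by
    refine le_of_tendsto (hlim atBot atBot_le_cocompact) ?_
    filter_upwards [eventually_le_atBot p] with y hy
    exact (hf.ofReal_abs_sub_le hae y p hy).trans (lintegral_mono_set Ioc_subset_Iic_self)
  have hright : ENNReal.ofReal (P m) ≤ ∫⁻ y in Ioi p, D y := by
    refine le_of_tendsto (hlim atTop atTop_le_cocompact) ?_
    filter_upwards [eventually_ge_atTop p] with y hy
    rw [abs_sub_comm]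
    exact (hf.ofReal_abs_sub_le hae p y hy).trans (lintegral_mono_set Ioc_subset_Ioi_self)
  calc ENNReal.ofReal (2 * P m) = ENNReal.ofReal (P m) + ENNReal.ofReal (P m) := by
        rw [two_mul, ENNReal.ofReal_add hPm hPm]
    _ ≤ (∫⁻ y in Iic p, D y) + ∫⁻ y in Ioi p, D y := add_le_add hleft hright
    _ = ∫⁻ y, D y := by
        rw [← compl_Iic, lintegral_add_compl _ measurableSet_Iic]
    _ = _ := lintegral_indicator hSm _

/-! ### The lower bound on the energy -/

lemma genInv_antitone (z : ℝ≥0 → ℝ≥0∞) : Antitone (genInv z) := fun _ _ hst =>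
  iInf_mono fun _ => iInf_mono' fun h => ⟨h.trans (by exact_mod_cast hst), le_rfl⟩

lemma genInv_le {z : ℝ≥0 → ℝ≥0∞} {x y : ℝ≥0} (h : z y ≤ x) : genInv z x ≤ y := iInf₂_le y h

lemma lt_of_lt_genInv {z : ℝ≥0 → ℝ≥0∞} {x y : ℝ≥0} (h : (y : ℝ≥0∞) < genInv z x) :
    (x : ℝ≥0∞) < z y := by
  by_contra! hcon
  exact absurd (genInv_le hcon) (not_le.2 h)

lemma le_genInv_of_lt {z : ℝ≥0 → ℝ≥0∞} (hz : Antitone z) {x y : ℝ≥0} (h : (x : ℝ≥0∞) < z y) :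
    (y : ℝ≥0∞) ≤ genInv z x := by
  refine le_iInf₂ fun u hu => ?_
  by_contra! hcon
  have : u ≤ y := by exact_mod_cast hcon.le
  exact absurd (h.trans_le (hz this)) (not_lt.2 hu)

/-- The integral representation `√(b - t) = ∫_{t < s < b} ds / (2 √(s - t))`, which linearizes the
square root in the energy estimates. For `b ≤ t` both sides vanish. -/
lemma lintegral_ite_inv_sqrt (t b : ℝ≥0) :
    ∫⁻ s in Ioi (t : ℝ), (if ((s.toNNReal : ℝ≥0) : ℝ≥0∞) < (b : ℝ≥0∞) then
      ENNReal.ofReal (1 / (2 * √(s - t))) else 0) = ENNReal.ofReal (√((b : ℝ) - t)) := by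
  rw [← lintegral_Ioo_inv_sqrt, ← lintegral_indicator measurableSet_Ioi,
    ← lintegral_indicator measurableSet_Ioo]
  refine lintegral_congr fun s => ?_
  by_cases h1 : (t : ℝ) < s
  · have hs : 0 ≤ s := t.2.trans h1.le
    have : (((s.toNNReal : ℝ≥0) : ℝ≥0∞) < (b : ℝ≥0∞)) ↔ s < b := by
      rw [ENNReal.coe_lt_coe, ← NNReal.coe_lt_coe, Real.coe_toNNReal _ hs]
    by_cases h2 : s < b <;> simp [indicator, h1, h2, this]
  · simp [indicator, h1]

lemma measurableSet_toNNReal_lt {z : ℝ≥0 → ℝ≥0∞} (hz : Antitone z) {ψ : ℝ → ℝ}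
    (hψ : Measurable ψ) :
    MeasurableSet {q : ℝ × ℝ | ((q.2.toNNReal : ℝ≥0) : ℝ≥0∞) < z ‖ψ q.1‖₊} := by
  refine measurableSet_lt ?_ ?_
  · exact measurable_coe_nnreal_ennreal.comp (measurable_real_toNNReal.comp measurable_snd)
  · exact hz.measurable.comp (hψ.comp measurable_fst).nnnorm

/-- The Modica–Mortola type lower bound: by Young's inequality the energy of a profile that
reaches the height `M` exceeds `t w` at least by `∫ √(2 ψ (z(ψ) - t)) |ψ'|`, and the square root is
resolved by the layer cake formula. -/
lemma le_energy {z : ℝ≥0 → ℝ≥0∞} (hz_fin : ∀ φ : ℝ≥0, 0 < φ → z φ ≠ ⊤) (hz : Antitone z)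
    {ψ : ℝ → ℝ} {w : ℝ≥0} (h : IsPhaseField ψ w) (h0 : ∀ y, 0 ≤ ψ y)
    (hlim : Tendsto ψ (cocompact ℝ) (𝓝 0)) {p : ℝ} {M : ℝ≥0} (hp : ψ p = M)
    (hmax : ∀ y, ψ y ≤ M) {t : ℝ≥0} (ht : (t : ℝ≥0∞) ≤ z M) :
    (t : ℝ≥0∞) * w + ∫⁻ s in Ioi (t : ℝ), ENNReal.ofReal (kernelR (t - s)) *
      (min (M : ℝ≥0∞) (genInv z s.toNNReal)) ^ (3 / 2 : ℝ) ≤ energy (phaseFieldCost z) ψ := by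
  classical
  have hac : LocAbsCont ψ := h.absCont
  have hψm : Measurable ψ := hac.continuous.measurable
  set A : ℝ → ℝ≥0∞ := fun y => ENNReal.ofReal (|deriv ψ y| * √(2 * ψ y)) with hA
  set B : ℝ → ℝ≥0∞ := fun s => ENNReal.ofReal (1 / (2 * √(s - t))) with hB
  have hAm : Measurable A := by have := measurable_deriv ψ; fun_prop
  have hBm : Measurable B := by fun_prop
  -- pointwise Young inequality
  have hpt : ∀ y, (t : ℝ≥0∞) * ENNReal.ofReal (ψ y) + ∫⁻ s in Ioi (t : ℝ),
      (if ((s.toNNReal : ℝ≥0) : ℝ≥0∞) < z ‖ψ y‖₊ then A y * B s else 0) ≤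
      energyDensity (phaseFieldCost z) ψ y := by
    intro y
    have hle : ‖ψ y‖₊ ≤ M := by
      rw [← NNReal.coe_le_coe, coe_nnnorm, Real.norm_of_nonneg (h0 y)]; exact hmax y
    rcases (h0 y).eq_or_lt with hy | hy
    · simp [hA, ← hy]
    · have hpos : 0 < ‖ψ y‖₊ := by simpa using hy.ne'
      obtain ⟨b, hb⟩ : ∃ b : ℝ≥0, (b : ℝ≥0∞) = z ‖ψ y‖₊ :=
        ⟨_, ENNReal.coe_toNNReal (hz_fin _ hpos)⟩
      have htb : t ≤ b := by
        have := ht.trans (hz hle)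
        rw [← hb] at this; exact_mod_cast this
      have h1 : ∀ s : ℝ, (if ((s.toNNReal : ℝ≥0) : ℝ≥0∞) < (b : ℝ≥0∞) then A y * B s else 0) =
          A y * (if ((s.toNNReal : ℝ≥0) : ℝ≥0∞) < (b : ℝ≥0∞) then B s else 0) := fun s => by
        split_ifs <;> simp
      have hnn : ((‖ψ y‖₊ : ℝ≥0) : ℝ≥0∞) = ENNReal.ofReal (ψ y) := by
        rw [← Real.enorm_eq_ofReal (h0 y)]; rfl
      have htb' : (t : ℝ) ≤ b := htb
      simp only [← hb, h1]
      rw [lintegral_const_mul' _ _ ENNReal.ofReal_ne_top, lintegral_ite_inv_sqrt, energyDensity,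
        phaseFieldCost, ← hb, hnn, ← ENNReal.ofReal_coe_nnreal, ← ENNReal.ofReal_coe_nnreal,
        ← ENNReal.ofReal_mul (by positivity), ← ENNReal.ofReal_mul (by positivity),
        ← ENNReal.ofReal_mul (by positivity), ← ENNReal.ofReal_add (by positivity) (by positivity),
        ← ENNReal.ofReal_add (by positivity) (by positivity)]
      refine ENNReal.ofReal_le_ofReal ?_
      have h2 := Real.sq_sqrt (show 0 ≤ 2 * ψ y by linarith)
      have h3 := Real.sq_sqrt (show 0 ≤ (b : ℝ) - t by linarith)
      have h4 : (√(2 * ψ y) * √((b : ℝ) - t)) ^ 2 = 2 * ψ y * (b - t) := by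
        rw [mul_pow, h2, h3]
      nlinarith [sq_nonneg (|deriv ψ y| - √(2 * ψ y) * √((b : ℝ) - t))]
  have hmeas : Measurable (fun q : ℝ × ℝ =>
      if ((q.2.toNNReal : ℝ≥0) : ℝ≥0∞) < z ‖ψ q.1‖₊ then A q.1 * B q.2 else 0) :=
    Measurable.ite (measurableSet_toNNReal_lt hz hψm)
      ((hAm.comp measurable_fst).mul (hBm.comp measurable_snd)) measurable_const
  calc _ ≤ (t : ℝ≥0∞) * w + ∫⁻ s in Ioi (t : ℝ), ∫⁻ y,
        (if ((s.toNNReal : ℝ≥0) : ℝ≥0∞) < z ‖ψ y‖₊ then A y * B s else 0) := by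
        refine add_le_add le_rfl (setLIntegral_mono' measurableSet_Ioi fun s hs => ?_)
        have hs' : (t : ℝ) < s := hs
        set m : ℝ≥0 := (min (M : ℝ≥0∞) (genInv z s.toNNReal)).toNNReal with hm
        have hmc : (m : ℝ≥0∞) = min (M : ℝ≥0∞) (genInv z s.toNNReal) :=
          ENNReal.coe_toNNReal (ne_top_of_le_ne_top ENNReal.coe_ne_top (min_le_left _ _))
        have hmM : m ≤ M := by
          have : (m : ℝ≥0∞) ≤ M := hmc ▸ min_le_left _ _
          exact_mod_cast this
        have hSm : MeasurableSet {y | ((s.toNNReal : ℝ≥0) : ℝ≥0∞) < z ‖ψ y‖₊} :=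
          measurableSet_lt measurable_const (hz.measurable.comp hψm.nnnorm)
        have hsub : {y | ψ y < m} ⊆ {y | ((s.toNNReal : ℝ≥0) : ℝ≥0∞) < z ‖ψ y‖₊} := by
          intro y hy
          have hy' : ψ y < m := hy
          refine lt_of_lt_genInv (lt_of_lt_of_le ?_ (hmc.trans_le (min_le_right _ _)))
          rw [ENNReal.coe_lt_coe, ← NNReal.coe_lt_coe, coe_nnnorm, Real.norm_of_nonneg (h0 y)]
          exact hy'
        have h1 : ∀ y, (if ((s.toNNReal : ℝ≥0) : ℝ≥0∞) < z ‖ψ y‖₊ then A y * B s else 0) =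
            {y | ((s.toNNReal : ℝ≥0) : ℝ≥0∞) < z ‖ψ y‖₊}.indicator (fun y => A y * B s) y :=
          fun y => by simp [indicator]
        simp only [h1]
        rw [lintegral_indicator hSm, lintegral_mul_const _ hAm, ← hmc]
        calc ENNReal.ofReal (kernelR (t - s)) * (m : ℝ≥0∞) ^ (3 / 2 : ℝ)
            = ENNReal.ofReal (2 * (2 * √2 / 3 * (m : ℝ) ^ (3 / 2 : ℝ))) * B s := by
              rw [hB, ← ENNReal.ofReal_coe_nnreal (p := m),
                ENNReal.ofReal_rpow_of_nonneg m.coe_nonneg (by norm_num), kernelR,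
                if_pos (by linarith), ← ENNReal.ofReal_mul (by positivity),
                ← ENNReal.ofReal_mul (by positivity), neg_sub]
              congr 1
              have : √(s - t) ≠ 0 := (Real.sqrt_pos.2 (by linarith)).ne'
              field_simp
          _ ≤ _ := by
              gcongr
              exact (le_lintegral_deriv_mul_sqrt hac h0 hlim m.2
                (hp ▸ (NNReal.coe_le_coe.2 hmM))).trans (lintegral_mono_set hsub)
    _ = (t : ℝ≥0∞) * w + ∫⁻ y, ∫⁻ s in Ioi (t : ℝ),
        (if ((s.toNNReal : ℝ≥0) : ℝ≥0∞) < z ‖ψ y‖₊ then A y * B s else 0) := by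
        rw [lintegral_lintegral_swap]
        exact (hmeas.comp measurable_swap).aemeasurable
    _ = ∫⁻ y, ((t : ℝ≥0∞) * ENNReal.ofReal (ψ y) + ∫⁻ s in Ioi (t : ℝ),
        (if ((s.toNNReal : ℝ≥0) : ℝ≥0∞) < z ‖ψ y‖₊ then A y * B s else 0)) := by
        rw [lintegral_add_left (by fun_prop), lintegral_const_mul _ (by fun_prop),
          ← ofReal_integral_eq_lintegral_ofReal h.integrable (Eventually.of_forall h0), h.mass,
          ENNReal.ofReal_coe_nnreal]
    _ ≤ _ := lintegral_mono hpt

/-! ### Profiles with prescribed speed -/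

/-- The integral over the two mirror images of a half profile that is trivial on `(-∞, 0)`. -/
lemma lintegral_symmetrize {D : ℝ → ℝ≥0∞} (hD : ∀ x < 0, D x = 0) {L : ℝ} (hL : 0 ≤ L) :
    (∫⁻ y in Iic 0, D (y + L)) + ∫⁻ y in Ioi 0, D (L - y) = 2 * ∫⁻ x in Ioo 0 L, D x := by
  have h1 : ∫⁻ x in Iio L, D x = ∫⁻ x in Ioo 0 L, D x := by
    have hs : Iio L ∩ Iio 0 = Iio 0 := inter_eq_right.2 (Iio_subset_Iio hL)
    have hz : ∫⁻ x in Iio 0, D x = 0 := by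
      rw [setLIntegral_congr_fun (g := fun _ => 0) measurableSet_Iio fun x hx => hD x hx]; simp
    rw [← lintegral_inter_add_sdiff D (Iio L) (measurableSet_Iio (a := (0 : ℝ))), hs, hz, zero_add]
    refine (setLIntegral_congr ?_).symm
    have : Iio L \ Iio 0 = Ico 0 L := by ext x; simp [and_comm]
    rw [this]; exact Ioo_ae_eq_Ico
  rw [setLIntegral_Iic_comp_add_right, setLIntegral_Ioi_comp_sub_left, zero_add, sub_zero,
    ← setLIntegral_congr Iio_ae_eq_Iic, h1, two_mul]

/-- The even profile with maximum `m` that crosses each level `x ∈ (0, m)` with speed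
`|ψ'| = k x`. It is the inverse of the travel time `Y(x) = ∫₀ˣ 1/k`, reflected at the maximum. -/
lemma exists_profile {e : ℝ≥0 → ℝ≥0∞} (he0 : e 0 = 0) {k : ℝ → ℝ} (hk : ContinuousOn k (Ioi 0))
    {σ : ℝ} (hσ : 0 < σ) (hσk : ∀ x, σ ≤ k x) {m : ℝ} (hm : 0 < m)
    {w : ℝ≥0}
    (hw : 2 * ∫⁻ x in Ioo 0 m, ENNReal.ofReal (1 / k x) * ENNReal.ofReal x = w) :
    ∃ ψ, IsPhaseField ψ w ∧ energy e ψ = 2 * ∫⁻ x in Ioo 0 m, ENNReal.ofReal (1 / k x) *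
      (ENNReal.ofReal (1 / 2 * |k x| ^ 2) + e x.toNNReal) := by
  classical
  have hk0 : ∀ x, 0 < k x := fun x => hσ.trans_le (hσk x)
  -- outside `(0, m)` the integrand of the travel time is `1`, so that `Y` is bijective on `ℝ`
  set T : ℝ → ℝ := (Ioo 0 m).piecewise (fun x => 1 / k x) (fun _ => 1) with hT
  have hTin : ∀ x ∈ Ioo 0 m, T x = 1 / k x := fun x hx => piecewise_eq_of_mem _ _ _ hx
  have hTout : ∀ x ∉ Ioo 0 m, T x = 1 := fun x hx => piecewise_eq_of_notMem _ _ _ hx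
  have hT0 : ∀ x, 0 < T x := fun x => by
    by_cases hx : x ∈ Ioo 0 m
    · rw [hTin x hx]; exact one_div_pos.2 (hk0 x)
    · rw [hTout x hx]; exact one_pos
  have hTm : Measurable T := ContinuousOn.measurable_piecewise
    (continuousOn_const.div (hk.mono fun x hx => hx.1) fun x _ => (hk0 x).ne')
    continuousOn_const measurableSet_Ioo
  have hTb : ∀ x, ‖T x‖ ≤ max (1 / σ) 1 := fun x => by
    rw [Real.norm_of_nonneg (hT0 x).le]
    by_cases hx : x ∈ Ioo 0 m
    · rw [hTin x hx]
      exact (one_div_le_one_div_of_le hσ (hσk x)).trans (le_max_left _ _)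
    · rw [hTout x hx]; exact le_max_right _ _
  have hTi : ∀ a b, IntervalIntegrable T volume a b := fun a b =>
    (intervalIntegrable_const (c := max (1 / σ) 1)).mono_fun hTm.aestronglyMeasurable
      (Eventually.of_forall fun x => (hTb x).trans (le_abs_self _))
  set Y : ℝ → ℝ := fun x => ∫ s in (0 : ℝ)..x, T s with hY
  have hYsub : ∀ a b, Y b - Y a = ∫ s in a..b, T s := fun a b =>
    intervalIntegral.integral_interval_sub_left (hTi 0 b) (hTi 0 a)
  have hYc : Continuous Y := intervalIntegral.continuous_primitive hTi 0
  have hYmono : StrictMono Y := fun a b hab => by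
    have := intervalIntegral.intervalIntegral_pos_of_pos (hTi a b) hT0 hab
    rw [← hYsub] at this; linarith
  have hY0 : Y 0 = 0 := intervalIntegral.integral_same
  have hYneg : ∀ x ≤ 0, Y x = x := fun x hx => by
    rw [hY]
    dsimp only
    rw [intervalIntegral.integral_congr (g := fun _ => (1 : ℝ))]
    · simp
    · intro s hs
      rw [uIcc_of_ge hx] at hs
      exact hTout s fun h => absurd h.1 (not_lt.2 hs.2)
  have hYbig : ∀ x ≥ m, Y x = Y m + (x - m) := fun x hx => by
    have : ∫ s in m..x, T s = ∫ s in m..x, (1 : ℝ) := by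
      refine intervalIntegral.integral_congr fun s hs => ?_
      rw [uIcc_of_le hx] at hs
      exact hTout s fun h => absurd h.2 (not_lt.2 hs.1)
    rw [← hYsub] at this
    simp at this
    linarith
  have hYsurj : Function.Surjective Y := by
    refine hYc.surjective ?_ ?_
    · refine (tendsto_atTop_add_const_left _ (Y m)
        (tendsto_atTop_add_const_right _ (-m) tendsto_id)).congr' ?_
      filter_upwards [eventually_ge_atTop m] with x hx
      rw [hYbig x hx]; simp [sub_eq_add_neg]
    · refine tendsto_id.congr' ?_
      filter_upwards [eventually_le_atBot 0] with x hx
      rw [hYneg x hx]; rfl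
  set U := hYmono.orderIsoOfSurjective Y hYsurj with hU
  set u : ℝ → ℝ := fun y => U.symm y with hu
  have hYu : ∀ y, Y (u y) = y := fun y => U.apply_symm_apply y
  have huY : ∀ x, u (Y x) = x := fun x => U.symm_apply_apply x
  have huc : Continuous u := U.symm.continuous
  have humono : StrictMono u := U.symm.strictMono
  set L := Y m with hL
  have hL0 : 0 < L := by rw [← hY0]; exact hYmono hm
  have hu0 : u 0 = 0 := by simpa only [hY0] using huY 0
  have huL : u L = m := huY m
  have hYder : ∀ x ∈ Ioo 0 m, HasDerivAt Y (1 / k x) x := fun x hx => by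
    have hev : T =ᶠ[𝓝 x] fun x => 1 / k x := by
      filter_upwards [Ioo_mem_nhds hx.1 hx.2] with y hy using hTin y hy
    have hct : ContinuousAt T x := by
      refine ContinuousAt.congr ?_ hev.symm
      exact continuousAt_const.div (hk.continuousAt (Ioi_mem_nhds hx.1)) (hk0 x).ne'
    rw [← hTin x hx]
    exact intervalIntegral.integral_hasDerivAt_right (hTi 0 x)
      (hTm.stronglyMeasurable.stronglyMeasurableAtFilter) hct
  have hmem : ∀ y ∈ Ioo 0 L, u y ∈ Ioo 0 m := fun y hy =>
    ⟨hu0 ▸ humono hy.1, huL ▸ humono hy.2⟩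
  have huder : ∀ y ∈ Ioo 0 L, HasDerivAt u (k (u y)) y := fun y hy => by
    have := HasDerivAt.of_local_left_inverse (f := Y) huc.continuousAt (hYder _ (hmem y hy))
      (one_div_pos.2 (hk0 _)).ne' (Eventually.of_forall hYu)
    simpa using this
  have himg : Y '' Ioo 0 m = Ioo 0 L := by
    ext y
    constructor
    · rintro ⟨x, hx, rfl⟩
      exact ⟨hY0 ▸ hYmono hx.1, hYmono hx.2⟩
    · intro hy
      exact ⟨u y, hmem y hy, hYu y⟩
  have hchange : ∀ F : ℝ → ℝ≥0∞, ∫⁻ y in Ioo 0 L, F (u y) =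
      ∫⁻ x in Ioo 0 m, ENNReal.ofReal (1 / k x) * F x := fun F => by
    rw [← himg, lintegral_image_eq_lintegral_abs_deriv_mul measurableSet_Ioo
      (fun x hx => (hYder x hx).hasDerivWithinAt) hYmono.injective.injOn]
    refine setLIntegral_congr_fun measurableSet_Ioo fun x hx => ?_
    rw [huY, abs_of_pos (one_div_pos.2 (hk0 x))]
  -- `q` is `u` clamped to the range `[0, m]`; as `k` may be unbounded near `0`, its absolute
  -- continuity comes from the integrability of the nonnegative derivative of `u`
  set v : ℝ → ℝ := (Ioo 0 L).indicator fun y => k (u y) with hv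
  have hvi : Integrable v := by
    refine IntegrableOn.integrable_indicator ?_ measurableSet_Ioo
    exact (intervalIntegral.integrableOn_deriv_of_nonneg huc.continuousOn huder
      fun y _ => (hk0 _).le).mono_set Ioo_subset_Ioc_self
  set q : ℝ → ℝ := fun y => ∫ s in (0 : ℝ)..y, v s with hq
  have hqac : LocAbsCont q := LocAbsCont.of_eq_add_integral 0
    (fun a b => hvi.intervalIntegrable) fun x => by simp [hq]
  have hq0 : ∀ y ≤ 0, q y = 0 := fun y hy => by
    rw [hq]
    dsimp only
    rw [intervalIntegral.integral_congr (g := fun _ => (0 : ℝ))]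
    · simp
    · intro s hs
      rw [uIcc_of_ge hy] at hs
      exact indicator_of_notMem (fun h => absurd h.1 (not_lt.2 hs.2)) _
  have hqu : ∀ y ∈ Icc 0 L, q y = u y := fun y hy => by
    have h1 : q y = ∫ s in (0 : ℝ)..y, k (u s) := by
      refine intervalIntegral.integral_congr_ae ?_
      have : ∀ᵐ s : ℝ, s ≠ L := by simp [ae_iff, measure_singleton]
      filter_upwards [this] with s hs hs'
      rw [uIoc_of_le hy.1] at hs'
      exact indicator_of_mem (show s ∈ Ioo 0 L from ⟨hs'.1, lt_of_le_of_ne (hs'.2.trans hy.2) hs⟩) _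
    have hd : ∀ s ∈ Ioo 0 y, HasDerivAt u (k (u s)) s := fun s hs =>
      huder s ⟨hs.1, hs.2.trans_le hy.2⟩
    rw [h1, intervalIntegral.integral_eq_sub_of_hasDerivAt_of_le hy.1 huc.continuousOn hd, hu0,
      sub_zero]
    rw [intervalIntegrable_iff_integrableOn_Ioc_of_le hy.1]
    exact intervalIntegral.integrableOn_deriv_of_nonneg huc.continuousOn hd
      fun y _ => (hk0 _).le
  have hdens0 : ∀ y < 0, energyDensity e q y = 0 := fun y hy => by
    have : q =ᶠ[𝓝 y] fun _ => 0 := by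
      filter_upwards [Iio_mem_nhds hy] with x hx using hq0 x (le_of_lt hx)
    rw [energyDensity_congr e this, energyDensity_const]; simpa using he0
  have hdens : ∀ y ∈ Ioo 0 L, energyDensity e q y =
      ENNReal.ofReal (1 / 2 * |k (u y)| ^ 2) + e (u y).toNNReal := fun y hy => by
    have : q =ᶠ[𝓝 y] u := by
      filter_upwards [Ioo_mem_nhds hy.1 hy.2] with x hx using hqu x (Ioo_subset_Icc_self hx)
    rw [energyDensity_congr e this, energyDensity, (huder y hy).deriv]
    congr 2
    rw [Real.toNNReal_of_nonneg (hmem y hy).1.le]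
    ext; simp [abs_of_nonneg (hmem y hy).1.le]
  have hac' : LocAbsCont fun y => q (L - y) := by
    have := (hqac.comp_add_right L).comp_neg
    simpa only [neg_add_eq_sub] using this
  set ψ := glue 0 (fun y => q (y + L)) (fun y => q (L - y)) with hψ
  have hψac : LocAbsCont ψ := (hqac.comp_add_right L).glue hac' (by simp)
  have hq_nonneg : ∀ y, 0 ≤ q y := fun y => by
    rcases le_total y 0 with h | h
    · exact (hq0 y h).ge
    · exact intervalIntegral.integral_nonneg h fun s _ =>
        indicator_nonneg (fun s _ => (hk0 _).le) s
  have hψ0 : ∀ y, 0 ≤ ψ y := fun y => by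
    rcases le_or_gt y 0 with h | h
    · rw [hψ, glue_of_le _ _ h]; exact hq_nonneg _
    · rw [hψ, glue_of_lt _ _ h]; exact hq_nonneg _
  have hmass : ∫⁻ y, ENNReal.ofReal (ψ y) = w := by
    rw [← lintegral_add_compl _ (measurableSet_Iic (a := (0 : ℝ))), compl_Iic,
      setLIntegral_congr_fun (g := fun y => ENNReal.ofReal (q (y + L))) measurableSet_Iic
        (fun y hy => by simp only [hψ, glue_of_le _ _ hy]),
      setLIntegral_congr_fun (g := fun y => ENNReal.ofReal (q (L - y))) measurableSet_Ioi
        (fun y hy => by simp only [hψ, glue_of_lt _ _ hy]),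
      lintegral_symmetrize (D := fun y => ENNReal.ofReal (q y))
        (fun x hx => by simp [hq0 x hx.le]) hL0.le, ← hw, ← hchange fun x => ENNReal.ofReal x]
    congr 1
    exact setLIntegral_congr_fun measurableSet_Ioo fun y hy => by
      simp only [hqu y (Ioo_subset_Icc_self hy)]
  refine ⟨ψ, ⟨hψac, ?_, ?_⟩, ?_⟩
  · exact (lintegral_ofReal_ne_top_iff_integrable hψac.continuous.aestronglyMeasurable
      (Eventually.of_forall hψ0)).1 (by rw [hmass]; exact ENNReal.coe_ne_top)
  · rw [integral_eq_lintegral_of_nonneg_ae (Eventually.of_forall hψ0)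
      hψac.continuous.aestronglyMeasurable, hmass]; rfl
  · rw [hψ, energy_glue]
    simp only [energyDensity_comp_add, energyDensity_comp_sub]
    rw [lintegral_symmetrize hdens0 hL0.le, setLIntegral_congr_fun measurableSet_Ioo hdens,
      hchange fun x => ENNReal.ofReal (1 / 2 * |k x| ^ 2) + e x.toNNReal]

/-! ### A continuous majorant of the cost and the layer cake formula -/

/-- The mass-specific cost as a real function. Only positive arguments are meaningful: `z 0 = ∞`
would become `0`, and negative arguments are read as `0`. -/
noncomputable def realCost (z : ℝ≥0 → ℝ≥0∞) (x : ℝ) : ℝ := (z x.toNNReal).toReal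

section realCost

variable {z : ℝ≥0 → ℝ≥0∞}

lemma realCost_nonneg (x : ℝ) : 0 ≤ realCost z x := ENNReal.toReal_nonneg

lemma ofReal_realCost (hz_fin : ∀ φ : ℝ≥0, 0 < φ → z φ ≠ ⊤) {x : ℝ} (hx : 0 < x) :
    ENNReal.ofReal (realCost z x) = z x.toNNReal :=
  ENNReal.ofReal_toReal (hz_fin _ (Real.toNNReal_pos.2 hx))

lemma realCost_antitoneOn (hz_fin : ∀ φ : ℝ≥0, 0 < φ → z φ ≠ ⊤) (hz : Antitone z) :
    AntitoneOn (realCost z) (Ioi 0) := fun _ hx _ _ hxy =>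
  ENNReal.toReal_mono (hz_fin _ (Real.toNNReal_pos.2 hx)) (hz (Real.toNNReal_le_toNNReal hxy))

/-- The mean value of the cost over `[l x, x]`, a continuous majorant of the cost. -/
noncomputable def meanCost (z : ℝ≥0 → ℝ≥0∞) (l x : ℝ) : ℝ :=
  ((1 - l) * x)⁻¹ * ∫ s in (l * x)..x, realCost z s

lemma intervalIntegrable_realCost (hz_fin : ∀ φ : ℝ≥0, 0 < φ → z φ ≠ ⊤) (hz : Antitone z)
    {a b : ℝ} (ha : 0 < a) (hb : 0 < b) : IntervalIntegrable (realCost z) volume a b := by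
  refine AntitoneOn.intervalIntegrable ((realCost_antitoneOn hz_fin hz).mono fun x hx => ?_)
  exact lt_of_lt_of_le (lt_min ha hb) hx.1

lemma meanCost_mem (hz_fin : ∀ φ : ℝ≥0, 0 < φ → z φ ≠ ⊤) (hz : Antitone z)
    {l x : ℝ} (hl0 : 0 < l) (hl1 : l < 1) (hx : 0 < x) :
    realCost z x ≤ meanCost z l x ∧ meanCost z l x ≤ realCost z (l * x) := by
  have hlx : 0 < l * x := by positivity
  have hle : l * x ≤ x := by nlinarith
  have hpos : 0 < (1 - l) * x := mul_pos (by linarith) hx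
  have hi := intervalIntegrable_realCost hz_fin hz hlx hx
  have han := realCost_antitoneOn hz_fin hz
  constructor
  · have h := intervalIntegral.integral_mono_on hle (intervalIntegrable_const (c := realCost z x))
      hi fun s hs => han (hlx.trans_le hs.1) hx hs.2
    rw [intervalIntegral.integral_const, smul_eq_mul] at h
    rw [meanCost, ← div_eq_inv_mul, le_div_iff₀ hpos]
    linarith
  · have h := intervalIntegral.integral_mono_on hle hi
      (intervalIntegrable_const (c := realCost z (l * x)))
      fun s hs => han hlx (hlx.trans_le hs.1) hs.1
    rw [intervalIntegral.integral_const, smul_eq_mul] at h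
    rw [meanCost, ← div_eq_inv_mul, div_le_iff₀ hpos]
    linarith

lemma continuousOn_meanCost (hz_fin : ∀ φ : ℝ≥0, 0 < φ → z φ ≠ ⊤) (hz : Antitone z)
    {l : ℝ} (hl0 : 0 < l) (hl1 : l < 1) : ContinuousOn (meanCost z l) (Ioi 0) := by
  set P : ℝ → ℝ := fun x => ∫ s in (1 : ℝ)..x, realCost z s with hP
  have hPc : ContinuousOn P (Ioi 0) := fun x hx => by
    have hx : 0 < x := hx
    have hmin : 0 < min 1 (x / 2) := lt_min one_pos (by linarith)
    have h := intervalIntegral.continuousOn_primitive_interval' (a := 1)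
      (intervalIntegrable_realCost hz_fin hz hmin (b := max 1 (x + 1))
        (one_pos.trans_le (le_max_left _ _)))
      ⟨by simp, by simp⟩
    rw [uIcc_of_le ((min_le_left _ _).trans (le_max_left _ _))] at h
    exact (h.continuousAt (Icc_mem_nhds ((min_le_right _ _).trans_lt (by linarith))
      (lt_of_lt_of_le (by linarith) (le_max_right _ _)))).continuousWithinAt
  have h1 : ContinuousOn (fun x => ((1 - l) * x)⁻¹ * (P x - P (l * x))) (Ioi 0) := by
    refine ContinuousOn.mul (ContinuousOn.inv₀ (by fun_prop) fun x hx => ?_) (hPc.sub ?_)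
    · exact (mul_pos (by linarith) hx).ne'
    · exact hPc.comp (by fun_prop) fun x hx => mul_pos hl0 hx
  refine h1.congr fun x hx => ?_
  rw [meanCost, hP]
  dsimp only
  rw [intervalIntegral.integral_interval_sub_left
    (intervalIntegrable_realCost hz_fin hz one_pos hx)
    (intervalIntegrable_realCost hz_fin hz one_pos (mul_pos hl0 hx))]

end realCost

/-- Speed at level `x` of an optimal profile for the mass-specific cost `ζ` and the multiplier `t`,
by equipartition of energy: `½ |ψ'|² = ψ (ζ(ψ) - t)`, cut off at `0` where `ζ < t`. -/
noncomputable def speed (ζ : ℝ → ℝ) (t x : ℝ) : ℝ := √(2 * x * max (ζ x - t) 0)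

lemma speed_nonneg (ζ : ℝ → ℝ) (t x : ℝ) : 0 ≤ speed ζ t x := Real.sqrt_nonneg _

/-- The layer cake formula: resolve the square root and exchange the integrals. Up to null sets
`{x | s < z x}` is the interval `(0, z⁻¹(s))`, over which `√(2 x)` has the integral
`2√2/3 z⁻¹(s)^{3/2}`. -/
lemma lintegral_speed_le_conv {z : ℝ≥0 → ℝ≥0∞} (hz_fin : ∀ φ : ℝ≥0, 0 < φ → z φ ≠ ⊤)
    (hz : Antitone z) (t : ℝ≥0) :
    2 * ∫⁻ x in Ioi 0, ENNReal.ofReal (speed (realCost z) t x) ≤ conv (gOf z) kernelR t := by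
  classical
  set A : ℝ → ℝ≥0∞ := fun x => ENNReal.ofReal (√(2 * x)) with hA
  set B : ℝ → ℝ≥0∞ := fun s => ENNReal.ofReal (1 / (2 * √(s - t))) with hB
  have hAm : Measurable A := by fun_prop
  have hBm : Measurable B := by fun_prop
  have hmeas : Measurable (fun q : ℝ × ℝ =>
      if ((q.2.toNNReal : ℝ≥0) : ℝ≥0∞) < z q.1.toNNReal then A q.1 * B q.2 else 0) := by
    refine Measurable.ite (measurableSet_lt ?_ ?_)
      ((hAm.comp measurable_fst).mul (hBm.comp measurable_snd)) measurable_const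
    · exact measurable_coe_nnreal_ennreal.comp (measurable_real_toNNReal.comp measurable_snd)
    · exact hz.measurable.comp (measurable_real_toNNReal.comp measurable_fst)
  have h1 : ∀ x ∈ Ioi (0 : ℝ), ENNReal.ofReal (speed (realCost z) t x) =
      ∫⁻ s in Ioi (t : ℝ),
        (if ((s.toNNReal : ℝ≥0) : ℝ≥0∞) < z x.toNNReal then A x * B s else 0) := fun x hx => by
    have hx : 0 < x := hx
    obtain ⟨b, hb⟩ : ∃ b : ℝ≥0, (b : ℝ≥0∞) = z x.toNNReal :=
      ⟨_, ENNReal.coe_toNNReal (hz_fin _ (Real.toNNReal_pos.2 hx))⟩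
    have h2 : ∀ s : ℝ, (if ((s.toNNReal : ℝ≥0) : ℝ≥0∞) < (b : ℝ≥0∞) then A x * B s else 0) =
        A x * (if ((s.toNNReal : ℝ≥0) : ℝ≥0∞) < (b : ℝ≥0∞) then B s else 0) := fun s => by
      split_ifs <;> simp
    simp only [← hb, h2]
    rw [lintegral_const_mul' _ _ ENNReal.ofReal_ne_top, lintegral_ite_inv_sqrt,
      ← ENNReal.ofReal_mul (Real.sqrt_nonneg _), speed, realCost, ← hb, ENNReal.coe_toReal,
      Real.sqrt_mul (by positivity)]
    congr 2
    rcases le_total (b : ℝ) t with h | h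
    · rw [max_eq_right (by linarith), Real.sqrt_zero, Real.sqrt_eq_zero_of_nonpos (by linarith)]
    · rw [max_eq_left (by linarith)]
  rw [setLIntegral_congr_fun measurableSet_Ioi h1, lintegral_lintegral_swap hmeas.aemeasurable,
    ← lintegral_const_mul' _ _ (by simp), conv]
  calc _ ≤ ∫⁻ s in Ioi (t : ℝ), gOf z s.toNNReal * ENNReal.ofReal (kernelR (t - s)) := ?_
    _ ≤ _ := lintegral_mono_set fun s hs => t.2.trans (le_of_lt hs)
  refine setLIntegral_mono' measurableSet_Ioi fun s hs => ?_
  have hs : (t : ℝ) < s := hs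
  have hsq : 0 < √(s - t) := Real.sqrt_pos.2 (by linarith)
  have hker : kernelR (t - s) = 2 * √2 / (3 * √(s - t)) := by
    rw [kernelR, if_pos (by linarith), neg_sub]
  have hkpos : 0 < kernelR (t - s) := by rw [hker]; positivity
  rcases eq_or_ne (genInv z s.toNNReal) ⊤ with htop | htop
  · rw [gOf, htop, ENNReal.top_rpow_of_pos (by norm_num),
      ENNReal.top_mul (ENNReal.ofReal_pos.2 hkpos).ne']
    exact le_top
  obtain ⟨a, ha⟩ : ∃ a : ℝ≥0, (a : ℝ≥0∞) = genInv z s.toNNReal := ⟨_, ENNReal.coe_toNNReal htop⟩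
  have h3 : ∫⁻ x in Ioi 0,
      (if ((s.toNNReal : ℝ≥0) : ℝ≥0∞) < z x.toNNReal then A x * B s else 0) ≤
      ENNReal.ofReal (2 * √2 / 3 * (a : ℝ) ^ (3 / 2 : ℝ)) * B s := by
    rw [← lintegral_Ioo_sqrt a.coe_nonneg, ← lintegral_mul_const _ hAm,
      setLIntegral_congr (Ioo_ae_eq_Ioc (a := (0 : ℝ)) (b := a)),
      ← lintegral_indicator measurableSet_Ioi, ← lintegral_indicator measurableSet_Ioc]
    refine lintegral_mono fun x => ?_
    by_cases hx : 0 < x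
    · rw [indicator_of_mem (show x ∈ Ioi (0 : ℝ) from hx)]
      split_ifs with hlt
      · have := le_genInv_of_lt hz hlt
        rw [← ha, ENNReal.coe_le_coe, ← NNReal.coe_le_coe, Real.coe_toNNReal _ hx.le] at this
        rw [indicator_of_mem (show x ∈ Ioc (0 : ℝ) a from ⟨hx, this⟩)]
      · exact zero_le
    · rw [indicator_of_notMem (show x ∉ Ioi (0 : ℝ) from hx)]
      exact zero_le
  refine (mul_le_mul_right h3 2).trans (le_of_eq ?_)
  rw [gOf, ← ha, ← ENNReal.ofReal_coe_nnreal (p := a),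
    ENNReal.ofReal_rpow_of_nonneg a.coe_nonneg (by norm_num), hB, hker,
    ← ENNReal.ofReal_mul (by positivity), ← ENNReal.ofReal_mul (by positivity),
    show (2 : ℝ≥0∞) = ENNReal.ofReal 2 by simp, ← ENNReal.ofReal_mul (by norm_num)]
  congr 1
  field_simp

/-- Substituting `l x` for `x` relates the optimal value for the cost `ζ (l x)` to that for `ζ`. -/
lemma lintegral_speed_scale (ζ : ℝ → ℝ) (t : ℝ) {l : ℝ} (hl : 0 < l) :
    ENNReal.ofReal (l * √l) * ∫⁻ x in Ioi 0, ENNReal.ofReal (speed (fun x => ζ (l * x)) t x) =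
      ∫⁻ x in Ioi 0, ENNReal.ofReal (speed ζ t x) := by
  have himg : (fun x => l * x) '' Ioi (0 : ℝ) = Ioi 0 := by
    rw [image_mul_left_Ioi hl, mul_zero]
  conv_rhs => rw [← himg]
  rw [lintegral_image_eq_lintegral_abs_deriv_mul (f' := fun _ => l) measurableSet_Ioi
    (fun x _ => by simpa using ((hasDerivAt_id' x).const_mul l).hasDerivWithinAt)
    (mul_right_injective₀ hl.ne').injOn, ← lintegral_const_mul' _ _ ENNReal.ofReal_ne_top]
  refine setLIntegral_congr_fun measurableSet_Ioi fun x hx => ?_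
  rw [abs_of_pos hl, ENNReal.ofReal_mul hl.le, mul_assoc, ← ENNReal.ofReal_mul (Real.sqrt_nonneg _),
    speed, speed, ← Real.sqrt_mul hl.le]
  congr 3
  ring_nf

/-! ### The upper bound on the induced cost -/

/-- The maximum of a profile with given speed `k` can be adjusted to the prescribed mass
`2 ∫₀ᵐ x / k(x) dx`, with a bound on `m` that does not involve the lower bound `σ` of the speed. -/
lemma exists_max_of_mass {k : ℝ → ℝ} (hk : ContinuousOn k (Ioi 0)) {σ : ℝ} (hσ : 0 < σ)
    (hσk : ∀ x, σ ≤ k x) {C : ℝ} (hC : 0 < C) (hkC : ∀ x ≥ 1, k x ≤ C * x) {w : ℝ≥0}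
    (hw : 0 < w) :
    ∃ m, 0 < m ∧ m ≤ 1 + w * C / 2 ∧
      2 * ∫⁻ x in Ioo 0 m, ENNReal.ofReal (1 / k x) * ENNReal.ofReal x = w := by
  have hk0 : ∀ x, 0 < k x := fun x => hσ.trans_le (hσk x)
  set m₀ : ℝ := 1 + w * C / 2 with hm₀
  have hwr : (0 : ℝ) < w := hw
  have h1m : 1 ≤ m₀ := by rw [hm₀]; linarith [mul_pos hwr hC]
  set f : ℝ → ℝ := fun x => x / k x with hf
  have hfi : IntervalIntegrable f volume 0 m₀ := by
    rw [intervalIntegrable_iff_integrableOn_Ioc_of_le (by linarith)]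
    refine Integrable.of_bound (C := m₀ / σ) ?_ ?_
    · have hfc : ContinuousOn f (Ioc 0 m₀) :=
        continuousOn_id.div (hk.mono fun x hx => hx.1) fun x _ => (hk0 x).ne'
      exact hfc.aestronglyMeasurable measurableSet_Ioc
    · refine (ae_restrict_iff' measurableSet_Ioc).2 (Eventually.of_forall fun x hx => ?_)
      rw [hf, Real.norm_of_nonneg (div_nonneg hx.1.le (hk0 x).le)]
      have := hσk x
      have := hx.1
      have := hx.2
      gcongr
  set N : ℝ → ℝ := fun m => ∫ x in (0 : ℝ)..m, f x with hN
  have hNc : ContinuousOn N (Icc 0 m₀) := by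
    have := intervalIntegral.continuousOn_primitive_interval' hfi left_mem_uIcc
    rwa [uIcc_of_le (by linarith)] at this
  have hN0 : N 0 = 0 := intervalIntegral.integral_same
  have hNm : (w : ℝ) / 2 ≤ N m₀ := by
    have hi1 : IntervalIntegrable f volume 0 1 := hfi.mono_set (by
      rw [uIcc_of_le (by linarith), uIcc_of_le (by linarith)]
      exact Icc_subset_Icc_right h1m)
    have hi2 : IntervalIntegrable f volume 1 m₀ := hfi.mono_set (by
      rw [uIcc_of_le (by linarith), uIcc_of_le (by linarith)]
      exact Icc_subset_Icc_left zero_le_one)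
    have h1 : 0 ≤ ∫ x in (0 : ℝ)..1, f x :=
      intervalIntegral.integral_nonneg zero_le_one fun x hx => div_nonneg hx.1 (hk0 x).le
    have h2 : ∫ _x in (1 : ℝ)..m₀, 1 / C ≤ ∫ x in (1 : ℝ)..m₀, f x := by
      refine intervalIntegral.integral_mono_on h1m (by simp) hi2 fun x hx => ?_
      rw [hf, div_le_div_iff₀ hC (hk0 x)]
      linarith [hkC x hx.1]
    rw [intervalIntegral.integral_const, smul_eq_mul] at h2
    have h3 : (m₀ - 1) * (1 / C) = w / 2 := by rw [hm₀]; field_simp; ring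
    rw [hN]
    dsimp only
    rw [← intervalIntegral.integral_add_adjacent_intervals hi1 hi2]
    linarith
  obtain ⟨m, hm, hmw⟩ := intermediate_value_Icc (by linarith) hNc
    (show (w : ℝ) / 2 ∈ Icc (N 0) (N m₀) from ⟨by rw [hN0]; positivity, hNm⟩)
  have hm0 : 0 < m := by
    refine lt_of_le_of_ne hm.1 ?_
    rintro rfl
    rw [hN0] at hmw
    linarith
  refine ⟨m, hm0, hm.2, ?_⟩
  have hfm : IntegrableOn f (Ioo 0 m) :=
    ((intervalIntegrable_iff_integrableOn_Ioc_of_le (by linarith)).1 hfi).mono_set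
      (Ioo_subset_Ioc_self.trans (Ioc_subset_Ioc_right hm.2))
  have h4 : ∫⁻ x in Ioo 0 m, ENNReal.ofReal (f x) = ENNReal.ofReal (w / 2) := by
    rw [← ofReal_integral_eq_lintegral_ofReal hfm
      ((ae_restrict_iff' measurableSet_Ioo).2 (Eventually.of_forall fun x hx =>
        div_nonneg hx.1.le (hk0 x).le)), ← hmw, hN]
    dsimp only
    rw [intervalIntegral.integral_of_le hm0.le, integral_Ioc_eq_integral_Ioo]
  have h5 : ∀ x, ENNReal.ofReal (1 / k x) * ENNReal.ofReal x = ENNReal.ofReal (f x) := fun x => by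
    rw [← ENNReal.ofReal_mul (one_div_pos.2 (hk0 x)).le, hf]
    congr 1
    ring
  simp only [h5]
  rw [h4, show (2 : ℝ≥0∞) = ENNReal.ofReal 2 by simp, ← ENNReal.ofReal_mul (by norm_num),
    mul_div_cancel₀ _ (by norm_num), ENNReal.ofReal_coe_nnreal]

/-- The bound on the cost for the majorant `z(l x)`, which lies above the mean value of `z` over
`[l x, x]`. -/
lemma tauOf_le_add_lintegral_speed {z : ℝ≥0 → ℝ≥0∞} (hz_fin : ∀ φ : ℝ≥0, 0 < φ → z φ ≠ ⊤)
    (hz : Antitone z) (t : ℝ≥0) {w : ℝ≥0} (hw : 0 < w) {l : ℝ} (hl0 : 0 < l) (hl1 : l < 1) :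
    tauOf z w ≤ t * w + 2 * ∫⁻ x in Ioi 0,
      ENNReal.ofReal (speed (fun x => realCost z (l * x)) t x) := by
  set S := ∫⁻ x in Ioi 0, ENNReal.ofReal (speed (fun x => realCost z (l * x)) t x) with hS
  set C : ℝ := 1 + √(2 * realCost z l) with hC
  have hC0 : 0 < C := by positivity
  set m₀ : ℝ := 1 + w * C / 2 with hm₀
  -- the competitor whose speed exceeds the one for the averaged cost by `σ`
  have key : ∀ σ : ℝ, 0 < σ → σ ≤ 1 →
      tauOf z w ≤ t * w + 2 * (ENNReal.ofReal (σ * m₀) + S) := by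
    intro σ hσ hσ1
    set k : ℝ → ℝ := fun x => σ + speed (meanCost z l) t x with hk
    have hσk : ∀ x, σ ≤ k x := fun x => le_add_of_nonneg_right (Real.sqrt_nonneg _)
    have hk0 : ∀ x, 0 < k x := fun x => hσ.trans_le (hσk x)
    have hkc : ContinuousOn k (Ioi 0) := by
      refine continuousOn_const.add (ContinuousOn.sqrt ?_)
      refine ContinuousOn.mul (by fun_prop) ?_
      exact (continuous_id.max continuous_const).comp_continuousOn
        ((continuousOn_meanCost hz_fin hz hl0 hl1).sub continuousOn_const)
    have hspeed : ∀ x > 0, speed (meanCost z l) t x ≤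
        speed (fun x => realCost z (l * x)) t x := fun x hx => by
      have := (meanCost_mem hz_fin hz hl0 hl1 hx).2
      unfold speed
      gcongr
    have hkC : ∀ x ≥ 1, k x ≤ C * x := fun x hx => by
      have hx0 : 0 < x := by linarith
      have h1 : realCost z (l * x) ≤ realCost z l :=
        realCost_antitoneOn hz_fin hz hl0 (mul_pos hl0 hx0) (by nlinarith)
      have h2 : max (realCost z (l * x) - t) 0 ≤ realCost z l :=
        max_le (by linarith [t.coe_nonneg]) (realCost_nonneg _)
      have h3 : speed (fun x => realCost z (l * x)) t x ≤ √(2 * realCost z l) * x := by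
        rw [speed]
        refine Real.sqrt_le_iff.2 ⟨by positivity, ?_⟩
        rw [mul_pow, Real.sq_sqrt (mul_nonneg zero_le_two (realCost_nonneg _))]
        have h4 : x ≤ x ^ 2 := by nlinarith
        have h5 := realCost_nonneg (z := z) l
        calc 2 * x * max (realCost z (l * x) - t) 0 ≤ 2 * x ^ 2 * realCost z l := by gcongr
          _ = _ := by ring
      calc k x ≤ σ + speed (fun x => realCost z (l * x)) t x :=
            add_le_add le_rfl (hspeed x hx0)
        _ ≤ 1 * x + √(2 * realCost z l) * x := by linarith
        _ = C * x := by rw [hC]; ring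
    obtain ⟨m, hm0, hm, hmw⟩ := exists_max_of_mass hkc hσ hσk hC0 hkC hw
    obtain ⟨ψ, h1, h2⟩ := exists_profile (e := phaseFieldCost z) (by simp [phaseFieldCost])
      hkc hσ hσk hm0 hmw
    refine (tauOf_le h1).trans ?_
    rw [h2]
    have hkm : AEMeasurable k (volume.restrict (Ioo 0 m)) :=
      (hkc.mono fun x hx => hx.1).aemeasurable measurableSet_Ioo
    calc 2 * ∫⁻ x in Ioo 0 m, ENNReal.ofReal (1 / k x) *
          (ENNReal.ofReal (1 / 2 * |k x| ^ 2) + phaseFieldCost z x.toNNReal)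
        ≤ 2 * ∫⁻ x in Ioo 0 m, (t * (ENNReal.ofReal (1 / k x) * ENNReal.ofReal x) +
          (ENNReal.ofReal σ + ENNReal.ofReal (speed (fun x => realCost z (l * x)) t x))) := by
          gcongr 2 * ?_
          refine setLIntegral_mono' measurableSet_Ioo fun x hx => ?_
          have hx0 : 0 < x := hx.1
          have hsp := hspeed x hx0
          have hsq : 2 * x * (realCost z x - t) ≤ k x ^ 2 := by
            have h3 := (meanCost_mem hz_fin hz hl0 hl1 hx0).1
            have h4 : speed (meanCost z l) t x ^ 2 = 2 * x * max (meanCost z l x - t) 0 :=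
              Real.sq_sqrt (by positivity)
            have h5 : speed (meanCost z l) t x ≤ k x := by rw [hk]; linarith
            calc 2 * x * (realCost z x - t) ≤ 2 * x * max (meanCost z l x - t) 0 := by
                  gcongr
                  exact (sub_le_sub_right h3 _).trans (le_max_left _ _)
              _ = speed (meanCost z l) t x ^ 2 := h4.symm
              _ ≤ k x ^ 2 := pow_le_pow_left₀ (Real.sqrt_nonneg _) h5 2
          have hkx := hk0 x
          have h0 := realCost_nonneg (z := z) x
          rw [phaseFieldCost, ← ofReal_realCost hz_fin hx0, ← ENNReal.ofReal_coe_nnreal,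
            Real.coe_toNNReal _ hx0.le, ← ENNReal.ofReal_coe_nnreal,
            ← ENNReal.ofReal_mul hx0.le, ← ENNReal.ofReal_add (by positivity) (by positivity),
            ← ENNReal.ofReal_mul (by positivity), ← ENNReal.ofReal_mul (by positivity),
            ← ENNReal.ofReal_mul (by positivity),
            ← ENNReal.ofReal_add hσ.le (speed_nonneg _ _ _),
            ← ENNReal.ofReal_add (by positivity) (add_nonneg hσ.le (speed_nonneg _ _ _))]
          refine ENNReal.ofReal_le_ofReal ?_
          have h6 : t * (1 / k x * x) + k x ≤
              t * (1 / k x * x) + (σ + speed (fun x => realCost z (l * x)) t x) := by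
            have : k x = σ + speed (meanCost z l) t x := rfl
            linarith
          refine le_trans ?_ h6
          rw [sq_abs, ← sub_nonneg]
          have : t * (1 / k x * x) + k x - 1 / k x * (1 / 2 * k x ^ 2 + x * realCost z x) =
              (k x ^ 2 - 2 * x * (realCost z x - t)) / (2 * k x) := by
            field_simp; ring
          rw [this]
          exact div_nonneg (by linarith) (by positivity)
      _ = t * (2 * ∫⁻ x in Ioo 0 m, ENNReal.ofReal (1 / k x) * ENNReal.ofReal x) +
          2 * (ENNReal.ofReal (σ * m) + ∫⁻ x in Ioo 0 m,
            ENNReal.ofReal (speed (fun x => realCost z (l * x)) t x)) := by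
          have hm1 : AEMeasurable (fun x => ENNReal.ofReal (1 / k x) * ENNReal.ofReal x)
              (volume.restrict (Ioo 0 m)) :=
            (((aemeasurable_const (b := (1 : ℝ))).div hkm).ennreal_ofReal).mul
              (by fun_prop)
          rw [lintegral_add_left' (hm1.const_mul _), lintegral_const_mul' _ _ ENNReal.coe_ne_top,
            lintegral_add_left measurable_const, setLIntegral_const, Real.volume_Ioo, sub_zero,
            ENNReal.ofReal_mul hσ.le]
          ring
      _ ≤ t * w + 2 * (ENNReal.ofReal (σ * m₀) + S) := by
          rw [hmw]
          gcongr
          exact lintegral_mono_set Ioo_subset_Ioi_self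
  have hlim : Tendsto (fun σ : ℝ => (t : ℝ≥0∞) * w + 2 * (ENNReal.ofReal (σ * m₀) + S)) (𝓝[>] 0)
      (𝓝 ((t : ℝ≥0∞) * w + 2 * (ENNReal.ofReal (0 * m₀) + S))) := by
    refine Tendsto.mono_left ?_ nhdsWithin_le_nhds
    refine tendsto_const_nhds.add (ENNReal.Tendsto.const_mul ?_ (Or.inr (by simp)))
    exact (ENNReal.tendsto_ofReal ((continuous_id.mul continuous_const).tendsto 0)).add
      tendsto_const_nhds
  rw [zero_mul, ENNReal.ofReal_zero, zero_add] at hlim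
  refine ge_of_tendsto hlim ?_
  filter_upwards [Ioc_mem_nhdsGT one_pos] with σ hσ using key σ hσ.1 hσ.2

/-- The upper bound on the induced cost: every mass is carried by a profile satisfying the
equipartition of energy for the multiplier `t` up to an arbitrarily small error. -/
lemma tauOf_le_add_conv {z : ℝ≥0 → ℝ≥0∞} (hz_fin : ∀ φ : ℝ≥0, 0 < φ → z φ ≠ ⊤)
    (hz : Antitone z) (t w : ℝ≥0) : tauOf z w ≤ t * w + conv (gOf z) kernelR t := by
  rcases eq_or_ne w 0 with rfl | hw
  · rw [tauOf_zero]; exact zero_le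
  have key : ∀ l : ℝ, 0 < l → l < 1 →
      ENNReal.ofReal (l * √l) * tauOf z w ≤ t * w + conv (gOf z) kernelR t := by
    intro l hl0 hl1
    have hll : ENNReal.ofReal (l * √l) ≤ 1 := by
      rw [ENNReal.ofReal_le_one]
      exact mul_le_one₀ hl1.le (Real.sqrt_nonneg _) (Real.sqrt_le_one.2 hl1.le)
    calc ENNReal.ofReal (l * √l) * tauOf z w
        ≤ ENNReal.ofReal (l * √l) * (t * w + 2 * ∫⁻ x in Ioi 0,
            ENNReal.ofReal (speed (fun x => realCost z (l * x)) t x)) := by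
          gcongr
          exact tauOf_le_add_lintegral_speed hz_fin hz t (pos_iff_ne_zero.2 hw) hl0 hl1
      _ = ENNReal.ofReal (l * √l) * (t * w) +
          2 * ∫⁻ x in Ioi 0, ENNReal.ofReal (speed (realCost z) t x) := by
          rw [← lintegral_speed_scale (realCost z) t hl0]; ring
      _ ≤ 1 * (t * w) + conv (gOf z) kernelR t :=
          add_le_add (by gcongr) (lintegral_speed_le_conv hz_fin hz t)
      _ = _ := by rw [one_mul]
  have hlim : Tendsto (fun l : ℝ => ENNReal.ofReal (l * √l) * tauOf z w) (𝓝[<] 1)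
      (𝓝 (ENNReal.ofReal (1 * √1) * tauOf z w)) := by
    refine Tendsto.mono_left ?_ nhdsWithin_le_nhds
    refine ENNReal.Tendsto.mul_const (ENNReal.tendsto_ofReal ?_) (Or.inl (by simp))
    exact (continuous_id.mul Real.continuous_sqrt).tendsto 1
  rw [Real.sqrt_one, one_mul, ENNReal.ofReal_one, one_mul] at hlim
  refine le_of_tendsto hlim ?_
  filter_upwards [Ioo_mem_nhdsLT one_pos] with l hl using key l hl.1 hl.2

/-! ### Almost optimal profiles and the value of the conjugate -/

variable {z : ℝ≥0 → ℝ≥0∞}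

/-- Phase fields may be taken nonnegative, vanishing at infinity and with an attained maximum. -/
lemma exists_max_energy_lt (hz : Antitone z) {w : ℝ≥0} (hw : 0 < w) {E : ℝ≥0∞}
    (hE : tauOf z w < E) :
    ∃ (ψ : ℝ → ℝ) (p : ℝ) (M : ℝ≥0), IsPhaseField ψ w ∧ (∀ y, 0 ≤ ψ y) ∧
      Tendsto ψ (cocompact ℝ) (𝓝 0) ∧ ψ p = M ∧ 0 < M ∧ (∀ y, ψ y ≤ M) ∧
      energy (phaseFieldCost z) ψ < E := by
  obtain ⟨ψ, h1, h2, h3⟩ := exists_nonneg_energy_lt hz hw hE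
  have hlim := h1.tendsto_zero h3.ne_top
  obtain ⟨a, ha⟩ : ∃ a, 0 < ψ a := by
    by_contra! hcon
    have h4 : ∀ y, ψ y = 0 := fun y => le_antisymm (hcon y) (h2 y)
    have h5 := h1.mass
    simp only [h4, integral_zero] at h5
    exact hw.ne (by exact_mod_cast h5)
  obtain ⟨p, hp⟩ := (LocAbsCont.continuous h1.absCont).exists_forall_ge' a
    ((hlim.eventually_lt_const ha).mono fun y hy => hy.le)
  have hpos : 0 < ψ p := ha.trans_le (hp a)
  exact ⟨ψ, p, (ψ p).toNNReal, h1, h2, hlim, (Real.coe_toNNReal _ hpos.le).symm,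
    Real.toNNReal_pos.2 hpos, fun y => by rw [Real.coe_toNNReal _ hpos.le]; exact hp y, h3⟩

/-- If the cost is differentiable at a positive mass with slope `t`, then the maxima `M` of
almost optimal profiles satisfy `z(M) ≈ t`: inserting a plateau at the maximum costs `z(M)` per
mass, and cutting out mass saves at least `z(M)` per mass. -/
lemma exists_almost_optimal (hz_fin : ∀ φ : ℝ≥0, 0 < φ → z φ ≠ ⊤) (hz : Antitone z)
    {τ : ℝ≥0 → ℝ≥0} (hτ : ∀ w : ℝ≥0, (τ w : ℝ≥0∞) = tauOf z w) {w : ℝ≥0} (hw : 0 < w) {t : ℝ}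
    (ht : HasDerivAt (fun x : ℝ => (τ x.toNNReal : ℝ)) t w) {η : ℝ} (hη : 0 < η) :
    ∃ (ψ : ℝ → ℝ) (p : ℝ) (M b : ℝ≥0), IsPhaseField ψ w ∧ (∀ y, 0 ≤ ψ y) ∧
      Tendsto ψ (cocompact ℝ) (𝓝 0) ∧ ψ p = M ∧ (∀ y, ψ y ≤ M) ∧
      z M = b ∧ t - η ≤ b ∧ b ≤ t + η ∧
      energy (phaseFieldCost z) ψ ≤ ENNReal.ofReal (τ w + η) := by
  have hwr : (0 : ℝ) < w := hw
  have h1 := (hasDerivAt_iff_isLittleO.1 ht).def (half_pos hη)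
  obtain ⟨ε, hε, hball⟩ := Metric.eventually_nhds_iff.1 h1
  obtain ⟨δ, hδ0, hδ1, hδε, hδw⟩ : ∃ δ : ℝ, 0 < δ ∧ δ ≤ 1 ∧ δ < ε ∧ δ < w := by
    refine ⟨min 1 (min (ε / 2) (w / 2)), by positivity, min_le_left _ _, ?_, ?_⟩
    · exact ((min_le_right _ _).trans (min_le_left _ _)).trans_lt (by linarith)
    · exact ((min_le_right _ _).trans (min_le_right _ _)).trans_lt (by linarith)
  -- the derivative is compared with difference quotients of the fixed step `±δ`, and the profile is
  -- chosen with an energy excess below `δ η / 2`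
  have hup := hball (y := w + δ) (by simpa [abs_of_pos hδ0] using hδε)
  have hdn := hball (y := w - δ) (by simpa [abs_of_pos hδ0] using hδε)
  simp only [add_sub_cancel_left, sub_sub_cancel_left, Real.toNNReal_coe, smul_eq_mul,
    Real.norm_eq_abs, abs_neg, abs_of_pos hδ0] at hup hdn
  lift δ to ℝ≥0 using hδ0.le
  have hδw' : δ ≤ w := by exact_mod_cast hδw.le
  rw [← NNReal.coe_add, Real.toNNReal_coe] at hup
  rw [← NNReal.coe_sub hδw', Real.toNNReal_coe] at hdn
  have hE : tauOf z w < ENNReal.ofReal (τ w + η / 2 * δ) := by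
    rw [← hτ, ← ENNReal.ofReal_coe_nnreal]
    exact (ENNReal.ofReal_lt_ofReal_iff (by positivity)).2 (by linarith [mul_pos (half_pos hη) hδ0])
  obtain ⟨ψ, p, M, h2, h3, h4, h5, h6, h7, h8⟩ := exists_max_energy_lt hz hw hE
  obtain ⟨b, hb⟩ : ∃ b : ℝ≥0, (b : ℝ≥0∞) = z M := ⟨_, ENNReal.coe_toNNReal (hz_fin _ h6)⟩
  obtain ⟨F, hF⟩ : ∃ F : ℝ≥0, (F : ℝ≥0∞) = energy (phaseFieldCost z) ψ :=
    ⟨_, ENNReal.coe_toNNReal h8.ne_top⟩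
  have hFlt : (F : ℝ) < τ w + η / 2 * δ := by
    rw [← hF, ← ENNReal.ofReal_coe_nnreal] at h8
    exact (ENNReal.ofReal_lt_ofReal_iff (by positivity)).1 h8
  refine ⟨ψ, p, M, b, h2, h3, h4, h5, h7, hb.symm, ?_, ?_, ?_⟩
  -- a plateau of mass `δ` at the maximum
  · obtain ⟨ψ', h9, h10⟩ := exists_plateau (phaseFieldCost z) h2
      (a := p) (by rw [h5]; exact h6) δ
    have h11 := tauOf_le (z := z) h9
    have hM0 : (0 : ℝ) < M := h6
    have hn : ‖(M : ℝ)‖₊ = M := by ext; simp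
    have h12 : ENNReal.ofReal (δ / (M : ℝ)) * ((M : ℝ≥0∞) * b) = ((δ * b : ℝ≥0) : ℝ≥0∞) := by
      rw [← ENNReal.ofReal_coe_nnreal (p := M), ← ENNReal.ofReal_coe_nnreal (p := b),
        ← ENNReal.ofReal_mul hM0.le, ← ENNReal.ofReal_mul (by positivity),
        ← ENNReal.ofReal_coe_nnreal]
      congr 1
      push_cast
      field_simp
    rw [h10, h5, phaseFieldCost, hn, ← hb, h12, ← hF, ← hτ] at h11
    have h13 : (τ (w + δ) : ℝ) ≤ F + δ * b := by exact_mod_cast h11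
    have h14 := (abs_le.1 hup).1
    have h15 : δ * (t - η) ≤ δ * (b : ℝ) := by linarith
    exact le_of_mul_le_mul_left h15 hδ0
  -- an excision of mass `δ`
  · obtain ⟨ψ', h9, -, -, h10⟩ := exists_remove_mass hz h2 h3 (tsub_add_cancel_of_le hδw')
      (tsub_pos_of_lt (by exact_mod_cast hδw))
    have h11 := (add_le_add (tauOf_le (z := z) h9) le_rfl).trans (h10 M h7)
    rw [← hb, ← hF, ← hτ] at h11
    have h13 : (τ (w - δ) : ℝ) + δ * b ≤ F := by exact_mod_cast h11
    have h14 := (abs_le.1 hdn).1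
    have h15 : δ * (b : ℝ) ≤ δ * (t + η) := by linarith
    exact le_of_mul_le_mul_left h15 hδ0
  · rw [← hF, ← ENNReal.ofReal_coe_nnreal]
    refine ENNReal.ofReal_le_ofReal ?_
    have : η / 2 * δ ≤ η / 2 * 1 := by gcongr
    linarith

lemma measurable_gOf (z : ℝ≥0 → ℝ≥0∞) : Measurable (gOf z) :=
  (genInv_antitone z).measurable.pow_const _

lemma measurable_kernelR : Measurable kernelR := by
  unfold kernelR
  exact Measurable.ite measurableSet_Iio (by fun_prop) measurable_const

lemma kernelR_of_neg {s : ℝ} (hs : s < 0) : kernelR s = 2 * √2 / (3 * √(-s)) := if_pos hs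

lemma kernelR_of_nonneg {s : ℝ} (hs : 0 ≤ s) : kernelR s = 0 := if_neg (not_lt.2 hs)

lemma continuousAt_kernelR {s : ℝ} (hs : s < 0) : ContinuousAt kernelR s := by
  have h : ContinuousAt (fun s : ℝ => 2 * √2 / (3 * √(-s))) s := by
    refine ContinuousAt.div (by fun_prop) (by fun_prop) ?_
    have : 0 < √(-s) := Real.sqrt_pos.2 (by linarith)
    positivity
  refine h.congr ?_
  filter_upwards [Iio_mem_nhds hs] with x hx using (kernelR_of_neg hx).symm

/-- The lower bound for an almost optimal profile whose maximum `M` satisfies `|z(M) - t| ≤ η`: the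
truncation at `M` in `le_energy` has no effect for `s > t + η`, as then `z⁻¹(s) ≤ M`. -/
lemma setLIntegral_kernel_le (hz_fin : ∀ φ : ℝ≥0, 0 < φ → z φ ≠ ⊤) (hz : Antitone z)
    {τ : ℝ≥0 → ℝ≥0} (hτ : ∀ w : ℝ≥0, (τ w : ℝ≥0∞) = tauOf z w) {w : ℝ≥0} (hw : 0 < w) {t : ℝ}
    (ht0 : 0 ≤ t) (ht : HasDerivAt (fun x : ℝ => (τ x.toNNReal : ℝ)) t w) {η : ℝ} (hη : 0 < η) :
    ∫⁻ s in Ioi (t + η), ENNReal.ofReal (kernelR (max (t - η) 0 - s)) * gOf z s.toNNReal ≤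
      ENNReal.ofReal (τ w + η - max (t - η) 0 * w) := by
  obtain ⟨ψ, p, M, b, h1, h2, h3, h4, h5, h6, h7, h8, h9⟩ :=
    exists_almost_optimal hz_fin hz hτ hw ht hη
  set t' : ℝ≥0 := (max (t - η) 0).toNNReal with ht'
  have ht'c : (t' : ℝ) = max (t - η) 0 := Real.coe_toNNReal _ (le_max_right _ _)
  have hle : (t' : ℝ≥0∞) ≤ z M := by
    rw [h6, ENNReal.coe_le_coe, ← NNReal.coe_le_coe, ht'c]
    exact max_le h7 b.coe_nonneg
  have h10 := (le_energy hz_fin hz h1 h2 h3 h4 h5 hle).trans h9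
  rw [← ht'c]
  have h11 : ∫⁻ s in Ioi (t + η), ENNReal.ofReal (kernelR (t' - s)) * gOf z s.toNNReal ≤
      ∫⁻ s in Ioi (t' : ℝ), ENNReal.ofReal (kernelR (t' - s)) *
        (min (M : ℝ≥0∞) (genInv z s.toNNReal)) ^ (3 / 2 : ℝ) := by
    calc _ ≤ ∫⁻ s in Ioi (t + η), ENNReal.ofReal (kernelR (t' - s)) *
          (min (M : ℝ≥0∞) (genInv z s.toNNReal)) ^ (3 / 2 : ℝ) := by
          refine setLIntegral_mono' measurableSet_Ioi fun s hs => ?_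
          have hs : t + η < s := hs
          have h12 : genInv z s.toNNReal ≤ M := by
            refine genInv_le ?_
            rw [h6, ENNReal.coe_le_coe, ← NNReal.coe_le_coe, Real.coe_toNNReal _ (by linarith)]
            linarith
          rw [min_eq_right h12, gOf]
      _ ≤ _ := lintegral_mono_set (Ioi_subset_Ioi (by
          rw [ht'c]; exact max_le (by linarith) (by linarith)))
  rw [ENNReal.ofReal_sub _ (by positivity), ENNReal.ofReal_mul t'.coe_nonneg,
    ENNReal.ofReal_coe_nnreal, ENNReal.ofReal_coe_nnreal]
  refine h11.trans (ENNReal.le_sub_of_add_le_left ?_ h10)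
  exact ENNReal.mul_ne_top ENNReal.coe_ne_top ENNReal.coe_ne_top

/-- The lower bound at a positive mass, by Fatou's lemma along almost optimal profiles. -/
lemma conv_le_of_hasDerivAt (hz_fin : ∀ φ : ℝ≥0, 0 < φ → z φ ≠ ⊤) (hz : Antitone z)
    {τ : ℝ≥0 → ℝ≥0} (hτ : ∀ w : ℝ≥0, (τ w : ℝ≥0∞) = tauOf z w) {w : ℝ≥0} (hw : 0 < w) {t : ℝ}
    (ht0 : 0 ≤ t) (ht : HasDerivAt (fun x : ℝ => (τ x.toNNReal : ℝ)) t w) :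
    conv (gOf z) kernelR t ≤ ENNReal.ofReal (τ w - t * w) := by
  set η : ℕ → ℝ := fun n => 1 / ((n : ℝ) + 1) with hη
  have hη0 : ∀ n, 0 < η n := fun n => Nat.one_div_pos_of_nat
  have hηlim : Tendsto η atTop (𝓝 0) := tendsto_one_div_add_atTop_nhds_zero_nat
  have htlim : Tendsto (fun n => max (t - η n) 0) atTop (𝓝 t) := by
    have := (tendsto_const_nhds (x := t)).sub hηlim
    have := this.max (tendsto_const_nhds (x := (0 : ℝ)))
    rwa [sub_zero, max_eq_left ht0] at this
  set F : ℕ → ℝ → ℝ≥0∞ := fun n => (Ioi (t + η n)).indicator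
    fun s => ENNReal.ofReal (kernelR (max (t - η n) 0 - s)) * gOf z s.toNNReal with hF
  have hFm : ∀ n, Measurable (F n) := fun n => by
    refine Measurable.indicator (Measurable.mul ?_ ?_) measurableSet_Ioi
    · exact (measurable_kernelR.comp (measurable_const.sub measurable_id)).ennreal_ofReal
    · exact (measurable_gOf z).comp measurable_real_toNNReal
  have hFlim : ∀ s, t < s →
      Tendsto (fun n => F n s) atTop (𝓝 (gOf z s.toNNReal * ENNReal.ofReal (kernelR (t - s)))) := by
    intro s hs
    have hk : 0 < kernelR (t - s) := by
      have : 0 < √(-(t - s)) := Real.sqrt_pos.2 (by linarith)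
      rw [kernelR_of_neg (by linarith)]; positivity
    have h1 : Tendsto (fun n => ENNReal.ofReal (kernelR (max (t - η n) 0 - s)) * gOf z s.toNNReal)
        atTop (𝓝 (ENNReal.ofReal (kernelR (t - s)) * gOf z s.toNNReal)) := by
      refine ENNReal.Tendsto.mul_const (ENNReal.tendsto_ofReal ?_)
        (Or.inl (ENNReal.ofReal_pos.2 hk).ne')
      exact (continuousAt_kernelR (by linarith)).tendsto.comp (htlim.sub_const s)
    rw [mul_comm]
    refine h1.congr' ?_
    filter_upwards [hηlim.eventually_lt_const (show 0 < s - t by linarith)] with n hn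
    have hmem : s ∈ Ioi (t + η n) := show t + η n < s by linarith
    simp only [hF, indicator_of_mem hmem]
  calc conv (gOf z) kernelR t ≤ ∫⁻ s, liminf (fun n => F n s) atTop := by
        rw [conv, ← lintegral_indicator measurableSet_Ici]
        refine lintegral_mono fun s => ?_
        by_cases hs0 : s ∈ Ici (0 : ℝ)
        · rw [indicator_of_mem hs0]
          rcases lt_or_ge t s with hs | hs
          · exact (hFlim s hs).liminf_eq.ge
          · rw [kernelR_of_nonneg (by linarith)]; simp
        · rw [indicator_of_notMem hs0]; exact zero_le
    _ ≤ liminf (fun n => ∫⁻ s, F n s) atTop := lintegral_liminf_le hFm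
    _ ≤ liminf (fun n => ENNReal.ofReal (τ w + η n - max (t - η n) 0 * w)) atTop := by
        refine liminf_le_liminf (Eventually.of_forall fun n => ?_)
        simp only [hF]
        rw [lintegral_indicator measurableSet_Ioi]
        exact setLIntegral_kernel_le hz_fin hz hτ hw ht0 ht (hη0 n)
    _ = ENNReal.ofReal (τ w - t * w) := by
        refine (ENNReal.tendsto_ofReal ?_).liminf_eq
        have := ((tendsto_const_nhds (x := (τ w : ℝ))).add hηlim).sub (htlim.mul_const (w : ℝ))
        rwa [add_zero] at this

/-- If the cost has slope `t` at zero mass, then `z ≤ t` on the positive half line: profiles of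
small mass either stay below a given height, and then pay at least the corresponding value of `z`
per mass, or else they have an energy that is bounded away from zero. -/
lemma le_of_hasDerivWithinAt_zero (hz_fin : ∀ φ : ℝ≥0, 0 < φ → z φ ≠ ⊤) (hz : Antitone z)
    {τ : ℝ≥0 → ℝ≥0} (hτ : ∀ w : ℝ≥0, (τ w : ℝ≥0∞) = tauOf z w) {t : ℝ} (ht0 : 0 ≤ t)
    (ht : HasDerivWithinAt (fun x : ℝ => (τ x.toNNReal : ℝ)) t (Ici 0) 0) {φ : ℝ≥0} (hφ : 0 < φ) :
    z φ ≤ ENNReal.ofReal t := by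
  obtain ⟨b, hb⟩ : ∃ b : ℝ≥0, (b : ℝ≥0∞) = z φ := ⟨_, ENNReal.coe_toNNReal (hz_fin _ hφ)⟩
  by_contra! hcon
  have hbt : t < b := by
    rw [← hb, ← ENNReal.ofReal_coe_nnreal] at hcon
    exact (ENNReal.ofReal_lt_ofReal_iff_of_nonneg ht0).1 hcon
  have hb0 : (0 : ℝ) < b := ht0.trans_lt hbt
  have hτ0 : τ 0 = 0 := by
    have := hτ 0
    rw [tauOf_zero] at this
    exact_mod_cast this
  -- `κ` bounds from below the energy of every profile that exceeds the height `φ`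
  set κ : ℝ≥0∞ := (φ : ℝ≥0∞) ^ (3 / 2 : ℝ) * ENNReal.ofReal (√((b : ℝ) - (0 : ℝ≥0))) with hκ
  have hκ0 : 0 < κ := by
    refine ENNReal.mul_pos ?_ ?_
    · exact (ENNReal.rpow_pos (by exact_mod_cast hφ) ENNReal.coe_ne_top).ne'
    · exact (ENNReal.ofReal_pos.2 (Real.sqrt_pos.2 (by simpa using hb0))).ne'
  have h1 := (hasDerivWithinAt_iff_isLittleO.1 ht).def (half_pos (sub_pos.2 hbt))
  have h2 : ∀ᶠ x : ℝ in 𝓝[Ioi 0] 0, ENNReal.ofReal (b * x) < κ := by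
    have : Tendsto (fun x : ℝ => ENNReal.ofReal (b * x)) (𝓝 0) (𝓝 (ENNReal.ofReal (b * 0))) :=
      ENNReal.tendsto_ofReal ((continuous_const.mul continuous_id).tendsto 0)
    rw [mul_zero, ENNReal.ofReal_zero] at this
    exact (this.mono_left nhdsWithin_le_nhds).eventually_lt_const hκ0
  obtain ⟨x, ⟨h3, h4⟩, hx⟩ := (((h1.filter_mono (nhdsWithin_mono _ Ioi_subset_Ici_self)).and
    h2).and self_mem_nhdsWithin).exists
  have hx : 0 < x := hx
  lift x to ℝ≥0 using hx.le
  simp only [Real.toNNReal_coe, Real.toNNReal_zero, hτ0, NNReal.coe_zero, sub_zero, smul_eq_mul,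
    Real.norm_eq_abs, abs_of_pos hx] at h3
  have hlt : tauOf z x < ENNReal.ofReal (b * x) := by
    rw [← hτ, ← ENNReal.ofReal_coe_nnreal, ENNReal.ofReal_lt_ofReal_iff (by positivity)]
    nlinarith [(abs_le.1 h3).2]
  obtain ⟨ψ, p, M, h5, h6, h7, h8, -, h9, h10⟩ := exists_max_energy_lt hz
    (by exact_mod_cast hx) hlt
  rcases le_or_gt M φ with hM | hM
  · have h11 := le_energy hz_fin hz h5 h6 h7 h8 h9 (t := b) (hb.trans_le (hz hM))
    rw [ENNReal.ofReal_mul hb0.le, ENNReal.ofReal_coe_nnreal, ENNReal.ofReal_coe_nnreal] at h10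
    exact absurd (le_self_add.trans h11) (not_le.2 h10)
  · have h11 := le_energy hz_fin hz h5 h6 h7 h8 h9 (t := 0) (by simp)
    refine absurd ((le_trans ?_ le_add_self).trans h11) (not_le.2 (h10.trans h4))
    rw [hκ, ← lintegral_ite_inv_sqrt, ← lintegral_const_mul' _ _
      (ENNReal.rpow_ne_top_of_nonneg (by norm_num) ENNReal.coe_ne_top)]
    refine setLIntegral_mono' measurableSet_Ioi fun s hs => ?_
    have hs : 0 < s := hs
    split_ifs with hsb
    · rw [mul_comm]
      have hsq : 0 < √s := Real.sqrt_pos.2 hs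
      gcongr ENNReal.ofReal ?_ * ?_ ^ _
      · rw [NNReal.coe_zero, zero_sub, sub_zero, kernelR_of_neg (by linarith), neg_neg,
          div_le_div_iff₀ (by positivity) (by positivity)]
        have : 1 ≤ √2 := Real.one_le_sqrt.2 (by norm_num)
        nlinarith
      · rw [hb] at hsb
        exact le_min (by exact_mod_cast hM.le) (le_genInv_of_lt hz hsb)
    · simp

lemma conv_eq_zero {t : ℝ}
    (h : ∀ φ : ℝ≥0, 0 < φ → z φ ≤ ENNReal.ofReal t) : conv (gOf z) kernelR t = 0 := by
  rw [conv, setLIntegral_congr_fun (g := fun _ => 0) measurableSet_Ici fun s _ => ?_]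
  · simp
  rcases lt_or_ge t s with hs | hs
  · have h1 : genInv z s.toNNReal = 0 := by
      refine le_antisymm (ENNReal.le_of_forall_pos_le_add fun ε hε _ => ?_) zero_le
      rw [zero_add]
      exact genInv_le ((h ε hε).trans (ENNReal.ofReal_le_ofReal hs.le))
    rw [gOf, h1, ENNReal.zero_rpow_of_pos (by norm_num), zero_mul]
  · rw [kernelR_of_nonneg (by linarith)]; simp

lemma nonneg_of_hasDerivWithinAt (hz : Antitone z) {τ : ℝ≥0 → ℝ≥0}
    (hτ : ∀ w : ℝ≥0, (τ w : ℝ≥0∞) = tauOf z w) {w : ℝ≥0} {t : ℝ}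
    (ht : HasDerivWithinAt (fun x : ℝ => (τ x.toNNReal : ℝ)) t (Ici 0) w) : 0 ≤ t := by
  refine ht.nonneg_of_monotoneOn (uniqueDiffOn_Ici 0 _ w.coe_nonneg).accPt
    fun x _ y _ hxy => ?_
  have := tauOf_mono hz (Real.toNNReal_le_toNNReal hxy)
  rw [← hτ, ← hτ] at this
  exact_mod_cast this

end PhaseField

theorem mainTheorem4 (z : ℝ≥0 → ℝ≥0∞)
    (hz_fin : ∀ φ : ℝ≥0, 0 < φ → z φ ≠ ⊤)
    (hz_anti : Antitone z) (hz_lsc : LowerSemicontinuous z)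
    (τ : ℝ≥0 → ℝ≥0) (hτ : ∀ w : ℝ≥0, (τ w : ℝ≥0∞) = PhaseField.tauOf z w)
    (w : ℝ≥0) (t : ℝ)
    (ht : HasDerivWithinAt (fun x : ℝ => (τ x.toNNReal : ℝ)) t (Set.Ici 0) (w : ℝ)) :
    PhaseField.fenchelConj (fun x : ℝ => -PhaseField.extendBot τ (-x)) t =
      ((PhaseField.conv (PhaseField.gOf z) PhaseField.kernelR t : ℝ≥0∞) : EReal) := by
  have ht0 : 0 ≤ t := PhaseField.nonneg_of_hasDerivWithinAt hz_anti hτ ht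
  have hval : ∀ v : ℝ≥0, ((t * (-(v : ℝ)) : ℝ) : EReal) -
      -PhaseField.extendBot τ (-(-(v : ℝ))) = ((τ v - t * v : ℝ) : EReal) := fun v => by
    rw [neg_neg, PhaseField.extendBot, if_pos v.coe_nonneg, Real.toNNReal_coe, ← EReal.coe_neg,
      ← EReal.coe_sub]
    congr 1
    ring
  have hτ0 : τ 0 = 0 := by
    have := hτ 0
    rw [PhaseField.tauOf_zero] at this
    exact_mod_cast this
  refine le_antisymm (iSup_le fun x => ?_) ?_
  · rcases le_or_gt 0 (-x) with hx | hx
    · obtain ⟨v, hv⟩ : ∃ v : ℝ≥0, x = -(v : ℝ) := ⟨(-x).toNNReal, by simp [hx]⟩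
      subst hv
      rw [hval]
      have h1 := PhaseField.tauOf_le_add_conv hz_fin hz_anti t.toNNReal v
      rw [← hτ, Real.coe_toNNReal _ ht0] at h1
      rcases eq_or_ne (PhaseField.conv (PhaseField.gOf z) PhaseField.kernelR t) ⊤ with h | h
      · rw [h]; exact le_top
      · lift PhaseField.conv (PhaseField.gOf z) PhaseField.kernelR t to ℝ≥0 using h with C
        have h2 : (τ v : ℝ) ≤ t.toNNReal * v + C := by exact_mod_cast h1
        rw [Real.coe_toNNReal _ ht0] at h2
        have h3 : (τ v - t * v : ℝ) ≤ (C : ℝ) := by linarith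
        rw [EReal.coe_nnreal_eq_coe_real]
        exact EReal.coe_le_coe_iff.2 h3
    · dsimp only
      rw [PhaseField.extendBot, if_neg (not_le.2 hx), EReal.neg_bot, EReal.sub_top]
      exact bot_le
  · have hle : ∀ v : ℝ≥0, ((τ v - t * v : ℝ) : EReal) ≤
        PhaseField.fenchelConj (fun x : ℝ => -PhaseField.extendBot τ (-x)) t := fun v => by
      rw [← hval v]
      exact le_iSup (fun x : ℝ => ((t * x : ℝ) : EReal) - -PhaseField.extendBot τ (-x)) (-(v : ℝ))
    have hle0 : 0 ≤ PhaseField.fenchelConj (fun x : ℝ => -PhaseField.extendBot τ (-x)) t := by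
      simpa [hτ0] using hle 0
    rcases eq_or_ne w 0 with rfl | hw
    · rw [PhaseField.conv_eq_zero fun φ hφ =>
        PhaseField.le_of_hasDerivWithinAt_zero hz_fin hz_anti hτ ht0 (by simpa using ht) hφ]
      simpa using hle0
    · have hw' : 0 < w := pos_iff_ne_zero.2 hw
      have h1 := PhaseField.conv_le_of_hasDerivAt hz_fin hz_anti hτ hw' ht0
        (ht.hasDerivAt (Ici_mem_nhds hw'))
      calc ((PhaseField.conv (PhaseField.gOf z) PhaseField.kernelR t : ℝ≥0∞) : EReal)
          ≤ ((ENNReal.ofReal (τ w - t * w) : ℝ≥0∞) : EReal) := by exact_mod_cast h1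
        _ ≤ _ := by
          -- if `τ(w) - t w < 0`, the supremum still dominates the value `0` at zero mass
          rw [EReal.coe_ennreal_ofReal]
          rcases le_total (0 : ℝ) (τ w - t * w) with h | h
          · rw [max_eq_left h]; exact hle w
          · rw [max_eq_right h]; simpa using hle0
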